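/- Let $\mathcal B_0,\mathcal B_1,\mathcal B_2,\dots$ be nonzero finite dimensional $C^*$-algebras, each of the form $\bigoplus_j B(\mathcal H_j)$, regarded as block-diagonal matrices in a fixed canonical basis, with the trace, the transpose $a^T$ and the inner product $\langle a,b\rangle=\mathrm{Tr}(a^*b)$ of matrices. Let $\mathcal A_n=\mathcal B_n\otimes\mathcal B_{n-1}\otimes\dots\otimes\mathcal B_0$, and let $S_n:\mathcal A_n\to\mathcal A_{n-1}$ be the partial trace over $\mathcal B_n$, with adjoint $S_n^*(a)=I_{\mathcal B_n}\otimes a$. Write $\mathfrak S(\mathcal A)$ for the set of density operators (states) of $\mathcal A$ and $t_{\mathcal A}=\mathrm{Tr}\,I_{\mathcal A}$. Let $K\subseteq\mathfrak S(\mathcal B_0)$ be a section, that is, $K=[K]\cap\mathfrak S(\mathcal B_0)$ with $[K]$ the complex linear span of $K$; assume that $t_{\mathcal B_0}^{-1}I_{\mathcal B_0}\in K$ and put $J=[K]$. Linear maps $\mathcal A\to\mathcal B$ are identified with their Choi matrices $X\in\mathcal B\otimes\mathcal A$, where $X$ corresponds to the map $a\mapsto\mathrm{Tr}_{\mathcal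 A}[(I_{\mathcal B}\otimes a^T)X]$. Put $\mathcal C_J(\mathcal B_0):=K$, and for $n\ge 1$ let $\mathcal C_J(\mathcal B_0,\dots,\mathcal B_n)\subseteq\mathcal A_n$ be the set of all completely positive maps $\mathcal A_{n-1}\to\mathcal B_n$ that map $\mathcal C_J(\mathcal B_0,\dots,\mathcal B_{n-1})$ into $\mathfrak S(\mathcal B_n)$ (generalized supermaps). For $K=\mathfrak S(\mathcal B_0)$ write $\mathcal C(\mathcal B_0,\dots,\mathcal B_n)$. For $n\ge1$, two elements of $\mathcal C_J(\mathcal B_0,\dots,\mathcal B_n)$ are equivalent if they have the same value on every element of $\mathcal C_J(\mathcal B_0,\dots,\mathcal B_{n-1})$. Let $\tilde J$ be the linear span of $I_{\mathcal B_0}+(J^T)^\perp$, with the orthogonal complement taken in $\mathcal B_0$. Let $J_0=J$, $J_1=S_1^{-1}(\tilde J)\subseteq\mathcal A_1$, $J_{n}=S_{n}^{-1}(S_{n-1}^*(J_{n-2}))\subseteq\mathcal A_n$ for $n\ge 2$, and $c_n=\prod_{l=0}^{\lfloor (n-1)/2\rfloor}t_{\mathcal B_{n-1-2l}}$ for $n\ge1$.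 **Theorem.** Let $n\ge 1$. The set of all elements of $\mathcal C_J(\mathcal B_0,\dots,\mathcal B_{n+1})$ having the same value on equivalent elements of $\mathcal C_J(\mathcal B_0,\dots,\mathcal B_n)$ is \[ J_{n+1}\cap(\mathcal B_{n+1}\otimes\mathcal B_n\otimes J_{n-1})\cap c_{n+1}\mathfrak S(\mathcal A_{n+1}). \] In particular, if $K=\mathfrak S(\mathcal B_0)$, then this set equals \[ \mathcal C(\mathcal B_0,\dots,\mathcal B_{n+1})\cap\mathcal C(\mathcal B_0,\mathcal B_n,\mathcal B_{n+1},\mathcal B_1,\dots,\mathcal B_{n-1})\quad\text{if } n \text{ is odd}, \] \[ \mathcal C(\mathcal B_0,\dots,\mathcal B_{n+1})\cap\mathcal C(\mathcal B_n,\mathcal B_{n+1},\mathcal B_0,\dots,\mathcal B_{n-1})\quad\text{if } n \text{ is even}, \] where the second set is viewed as a set of operators in $\mathcal A_{n+1}$ through the canonical identification of the reordered tensor product with $\mathcal A_{n+1}$. (For $n=1$ the reordered sequence is $\mathcal B_0,\mathcal B_1,\mathcal B_2$.) -/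

import Mathlib

open scoped Kronecker Pointwise ComplexOrder

noncomputable section

namespace Supermap

/-! ### Finite dimensional C*-algebras and their tensor products -/

/-- The data of a (nonzero) finite dimensional C*-algebra `⨁ⱼ B(ℂ^{dim j})`. -/
structure FinDimCStar where
  /-- the number of direct summands -/
  blocks : ℕ
  /-- the dimensions of the underlying Hilbert spaces -/
  dim : Fin blocks → ℕ
  blocks_pos : 0 < blocks
  dim_pos : ∀ j, 0 < dim j

/-- The canonical basis of the Hilbert space `H = ⨁ⱼ ℂ^{dim j}`. -/
abbrev FinDimCStar.Idx (B : FinDimCStar) : Type := Σ j : Fin B.blocks, Fin (B.dim j)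

/-- The algebra itself: the block-diagonal elements of `B(H)`. -/
def FinDimCStar.alg (B : FinDimCStar) : Submodule ℂ (Matrix B.Idx B.Idx ℂ) where
  carrier := {M | ∀ x y : B.Idx, x.1 ≠ y.1 → M x y = 0}
  add_mem' := by
    intro M N hM hN x y h
    simp [hM x y h, hN x y h]
  zero_mem' := by
    intro x y _
    rfl
  smul_mem' := by
    intro c M hM x y h
    simp [hM x y h]

/-- The trace of the unit, `t_B = Tr I_B`. -/
def FinDimCStar.t (B : FinDimCStar) : ℂ := Matrix.trace (1 : Matrix B.Idx B.Idx ℂ)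

/-- The canonical basis of `Hₙ ⊗ (Hₙ₋₁ ⊗ (⋯ ⊗ H₀))`. -/
@[reducible] def TIdx (B : ℕ → FinDimCStar) : ℕ → Type
  | 0 => (B 0).Idx
  | n + 1 => (B (n + 1)).Idx × TIdx B n

instance TIdx.instFintype (B : ℕ → FinDimCStar) : (n : ℕ) → Fintype (TIdx B n)
  | 0 => inferInstanceAs (Fintype (B 0).Idx)
  | n + 1 =>
    letI := TIdx.instFintype B n
    inferInstanceAs (Fintype ((B (n + 1)).Idx × TIdx B n))

instance TIdx.instDecidableEq (B : ℕ → FinDimCStar) : (n : ℕ) → DecidableEq (TIdx B n)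
  | 0 => inferInstanceAs (DecidableEq (B 0).Idx)
  | n + 1 =>
    letI := TIdx.instDecidableEq B n
    inferInstanceAs (DecidableEq ((B (n + 1)).Idx × TIdx B n))

/-- Operators on `Hₙ ⊗ ⋯ ⊗ H₀`. -/
abbrev Op (B : ℕ → FinDimCStar) (n : ℕ) : Type := Matrix (TIdx B n) (TIdx B n) ℂ

section Generic

variable {ι κ : Type} [Fintype ι] [Fintype κ] [DecidableEq ι] [DecidableEq κ]

/-- The tensor product `L ⊗ M` of two spaces of operators, as a space of operators. -/
def tensor (L : Submodule ℂ (Matrix ι ι ℂ)) (M : Submodule ℂ (Matrix κ κ ℂ)) :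
    Submodule ℂ (Matrix (ι × κ) (ι × κ) ℂ) :=
  Submodule.span ℂ {X | ∃ a ∈ L, ∃ b ∈ M, X = a ⊗ₖ b}

/-- The partial trace over the left factor, `a ⊗ b ↦ Tr(a) b`. -/
def trLeft : Matrix (ι × κ) (ι × κ) ℂ →ₗ[ℂ] Matrix κ κ ℂ where
  toFun X := Matrix.of fun x y => ∑ i, X (i, x) (i, y)
  map_add' X Y := by
    ext x y
    simp [Finset.sum_add_distrib]
  map_smul' c X := by
    ext x y
    simp [Finset.mul_sum]

/-- The partial trace over the right factor, `a ⊗ b ↦ Tr(b) a`. -/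
def trRight : Matrix (ι × κ) (ι × κ) ℂ →ₗ[ℂ] Matrix ι ι ℂ where
  toFun X := Matrix.of fun i j => ∑ x, X (i, x) (j, x)
  map_add' X Y := by
    ext x y
    simp [Finset.sum_add_distrib]
  map_smul' c X := by
    ext x y
    simp [Finset.mul_sum]

/-- The map `b ↦ I ⊗ b`; by `trLeft_adjoint` it is the adjoint of the partial trace. -/
def trLeftAdj : Matrix κ κ ℂ →ₗ[ℂ] Matrix (ι × κ) (ι × κ) ℂ where
  toFun b := (1 : Matrix ι ι ℂ) ⊗ₖ b
  map_add' _ _ := Matrix.kronecker_add _ _ _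
  map_smul' _ _ := Matrix.kronecker_smul _ _ _

theorem trLeft_adjoint {ι κ : Type} [Fintype ι] [Fintype κ] [DecidableEq ι]
    (X : Matrix (ι × κ) (ι × κ) ℂ) (b : Matrix κ κ ℂ) :
    ((trLeft X).conjTranspose * b).trace = (X.conjTranspose * trLeftAdj b).trace := by
  simp only [Matrix.trace, Matrix.diag_apply, Matrix.mul_apply, Matrix.conjTranspose_apply,
    trLeft, trLeftAdj, LinearMap.coe_mk, AddHom.coe_mk, Matrix.of_apply, star_sum,
    Fintype.sum_prod_type, Matrix.kroneckerMap_apply, Matrix.one_apply, ite_mul, one_mul, zero_mul,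
    mul_ite, mul_zero, Finset.sum_mul]
  have h : ∀ x x₁ : κ, ∀ i : ι, (∑ j : ι, if j = i then star (X (j, x₁) (i, x)) * b x₁ x else 0) =
      star (X (i, x₁) (i, x)) * b x₁ x := by
    intro x x₁ i
    simp
  calc _ = ∑ x, ∑ i, ∑ x₁, star (X (i, x₁) (i, x)) * b x₁ x :=
        Finset.sum_congr rfl fun x _ => Finset.sum_comm
    _ = ∑ i, ∑ x, ∑ x₁, star (X (i, x₁) (i, x)) * b x₁ x := Finset.sum_comm
    _ = _ := by
        refine Finset.sum_congr rfl fun i _ => Finset.sum_congr rfl fun x _ => ?_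
        rw [Finset.sum_comm]
        exact Finset.sum_congr rfl fun x₁ _ => (h x x₁ i).symm

/-- The map with Choi matrix `X`: `a ↦ Tr_κ [(I ⊗ aᵀ) X]`. -/
def choiMap (X : Matrix (ι × κ) (ι × κ) ℂ) : Matrix κ κ ℂ →ₗ[ℂ] Matrix ι ι ℂ where
  toFun a := trRight (((1 : Matrix ι ι ℂ) ⊗ₖ a.transpose) * X)
  map_add' a b := by
    rw [Matrix.transpose_add, Matrix.kronecker_add, Matrix.add_mul, map_add]
  map_smul' c a := by
    rw [Matrix.transpose_smul, Matrix.kronecker_smul, Matrix.smul_mul, map_smul, RingHom.id_apply]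

/-- `Φ` is completely positive on the space `L`: for every `d`, the map `id ⊗ Φ` on
`M_d(ℂ) ⊗ L`, i.e. the blockwise application of `Φ`, is positive. -/
def IsCPOn (L : Submodule ℂ (Matrix κ κ ℂ)) (Φ : Matrix κ κ ℂ →ₗ[ℂ] Matrix ι ι ℂ) : Prop :=
  ∀ (d : ℕ) (M : Matrix (Fin d) (Fin d) (Matrix κ κ ℂ)), (∀ i j, M i j ∈ L) →
    (Matrix.comp (Fin d) (Fin d) κ κ ℂ M).PosSemidef →
    (Matrix.comp (Fin d) (Fin d) ι ι ℂ (M.map Φ)).PosSemidef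

/-- The states (density operators) of the algebra `A`. -/
def states (A : Submodule ℂ (Matrix κ κ ℂ)) : Set (Matrix κ κ ℂ) :=
  {ρ | ρ ∈ A ∧ ρ.PosSemidef ∧ ρ.trace = 1}

/-- `K` is a section of the state space of `A`: `K = [K] ∩ 𝔖(A)`. -/
def IsSection (A : Submodule ℂ (Matrix κ κ ℂ)) (K : Set (Matrix κ κ ℂ)) : Prop :=
  K = (Submodule.span ℂ K : Set (Matrix κ κ ℂ)) ∩ states A

/-- `J̃`, the subspace generated by `I + (Jᵀ)^⊥`, where the orthogonal complement is taken in
`A` for the inner product `⟨a, b⟩ = Tr(a* b)`. -/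
def tilde (A J : Submodule ℂ (Matrix κ κ ℂ)) : Submodule ℂ (Matrix κ κ ℂ) :=
  Submodule.span ℂ {Y | ∃ x ∈ A, (∀ a ∈ J, ((a.transpose).conjTranspose * x).trace = 0) ∧
    Y = 1 + x}

end Generic

/-- `Aₙ = Bₙ ⊗ ⋯ ⊗ B₀`. -/
def A (B : ℕ → FinDimCStar) : (n : ℕ) → Submodule ℂ (Op B n)
  | 0 => (B 0).alg
  | n + 1 => tensor (B (n + 1)).alg (A B n)

/-! ### Generalized supermaps -/

/-- The set `C_J(B₀, …, Bₙ)`, `J = [K]`, of (Choi matrices of) generalized supermaps: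
`C_J(B₀) = K`, and `C_J(B₀, …, Bₙ₊₁)` consists of the completely positive maps `Aₙ → Bₙ₊₁` that
map `C_J(B₀, …, Bₙ)` into the states of `Bₙ₊₁`. -/
def C (B : ℕ → FinDimCStar) (K : Set (Op B 0)) : (n : ℕ) → Set (Op B n)
  | 0 => K
  | n + 1 => {X | X ∈ A B (n + 1) ∧ IsCPOn (A B n) (choiMap X) ∧
      ∀ Y ∈ C B K n, choiMap X Y ∈ states (B (n + 1)).alg}

/-- Two elements of `C_J(B₀, …, Bₙ₊₁)` are equivalent if they have the same value on every
element of `C_J(B₀, …, Bₙ)` (for `n = 0`: on `K`). -/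
def Equivalent (B : ℕ → FinDimCStar) (K : Set (Op B 0)) (n : ℕ) (X₁ X₂ : Op B (n + 1)) : Prop :=
  ∀ a ∈ C B K n, choiMap X₁ a = choiMap X₂ a

/-- The elements of `C_J(B₀, …, Bₙ₊₂)` that have the same value on equivalent elements of
`C_J(B₀, …, Bₙ₊₁)`. -/
def respecting (B : ℕ → FinDimCStar) (K : Set (Op B 0)) (n : ℕ) : Set (Op B (n + 2)) :=
  {X | X ∈ C B K (n + 2) ∧
    ∀ Y₁ ∈ C B K (n + 1), ∀ Y₂ ∈ C B K (n + 1), Equivalent B K n Y₁ Y₂ →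
      choiMap X Y₁ = choiMap X Y₂}

/-- The partial trace `Sₙ₊₁ : Aₙ₊₁ → Aₙ` over `Bₙ₊₁`. -/
def S (B : ℕ → FinDimCStar) (n : ℕ) : Op B (n + 1) →ₗ[ℂ] Op B n := trLeft

/-- The adjoint `Sₙ₊₁* : Aₙ → Aₙ₊₁`. -/
def SAdj (B : ℕ → FinDimCStar) (n : ℕ) : Op B n →ₗ[ℂ] Op B (n + 1) := trLeftAdj

/-- The subspaces `J₀ = J`, `J₁ = S₁⁻¹(J̃)`, `Jₙ₊₂ = Sₙ₊₂⁻¹(Sₙ₊₁*(Jₙ))`; the inverse images are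
taken in `A₁`, `Aₙ₊₂`. -/
def Jsp (B : ℕ → FinDimCStar) (J : Submodule ℂ (Op B 0)) : (n : ℕ) → Submodule ℂ (Op B n)
  | 0 => J
  | 1 => A B 1 ⊓ (tilde (A B 0) J).comap (S B 0)
  | n + 2 => A B (n + 2) ⊓ ((Jsp B J n).map (SAdj B n)).comap (S B (n + 1))

/-- `cₙ`, the product of `t_{Bₙ₋₁₋₂ₗ}` over `0 ≤ l ≤ ⌊(n-1)/2⌋`. -/
def c (B : ℕ → FinDimCStar) (n : ℕ) : ℂ := ∏ l ∈ Finset.range ((n + 1) / 2), (B (n - 1 - 2 * l)).t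

/-! ### Reordering of tensor factors -/

/-- The components of a basis element of `Hₙ ⊗ ⋯ ⊗ H₀`. -/
def coord (B : ℕ → FinDimCStar) : (n : ℕ) → TIdx B n → (i : Fin (n + 1)) → (B i).Idx
  | 0, x => Fin.cons (α := fun i : Fin 1 => (B i).Idx) x (fun i => i.elim0)
  | n + 1, x => Fin.snoc (α := fun i : Fin (n + 2) => (B i).Idx) (coord B n x.2) x.1

/-- The basis element with given components. -/
def ofCoord (B : ℕ → FinDimCStar) : (n : ℕ) → ((i : Fin (n + 1)) → (B i).Idx) → TIdx B n
  | 0, f => f 0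
  | n + 1, f => (f (Fin.last (n + 1)), ofCoord B n (fun i => f i.castSucc))

/-- The canonical identification of the basis of `Hₙ ⊗ ⋯ ⊗ H₀` with the basis of
`H_{σ n} ⊗ ⋯ ⊗ H_{σ 0}`. -/
def reorder (B : ℕ → FinDimCStar) {n : ℕ} (σ : ℕ → ℕ) (hσ : ∀ i, i ≤ n → σ i ≤ n)
    (x : TIdx B n) : TIdx (fun i => B (σ i)) n :=
  ofCoord (fun i => B (σ i)) n fun i =>
    coord B n x ⟨σ i, Nat.lt_succ_of_le (hσ i (Nat.le_of_lt_succ i.isLt))⟩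

theorem coord_ofCoord (B : ℕ → FinDimCStar) (n : ℕ) (f : (i : Fin (n + 1)) → (B i).Idx) :
    coord B n (ofCoord B n f) = f := by
  induction n with
  | zero =>
    funext i
    obtain rfl : i = 0 := Fin.fin_one_eq_zero i
    rfl
  | succ n ih =>
    funext i
    refine Fin.lastCases ?_ (fun j => ?_) i
    · simp [coord, ofCoord]
    · simp [coord, ofCoord, ih]

theorem coord_reorder (B : ℕ → FinDimCStar) {n : ℕ} (σ : ℕ → ℕ) (hσ : ∀ i, i ≤ n → σ i ≤ n)
    (x : TIdx B n) (i : Fin (n + 1)) :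
    coord (fun i => B (σ i)) n (reorder B σ hσ x) i =
      coord B n x ⟨σ i, Nat.lt_succ_of_le (hσ i (Nat.le_of_lt_succ i.isLt))⟩ := by
  rw [reorder, coord_ofCoord]

/-- The set `C(B₀, …, Bₙ)` of supermaps for `K = 𝔖(B₀)`. -/
def CFull (B : ℕ → FinDimCStar) (n : ℕ) : Set (Op B n) := C B (states (B 0).alg) n

/-- The set `C(B_{σ 0}, …, B_{σ n})`, viewed as a set of operators on `Hₙ ⊗ ⋯ ⊗ H₀` through the
canonical identification of the reordered tensor products. -/
def CReordered (B : ℕ → FinDimCStar) {n : ℕ} (σ : ℕ → ℕ) (hσ : ∀ i, i ≤ n → σ i ≤ n) :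
    Set (Op B n) :=
  (fun X => X.submatrix (reorder B σ hσ) (reorder B σ hσ)) '' CFull (fun i => B (σ i)) n

/-- The order `0, n, n+1, 1, …, n-1` of the numbers `0, …, n+1` (`n ≥ 1`). -/
def oddOrder (n : ℕ) (i : ℕ) : ℕ :=
  if i = 0 then 0 else if i = 1 then n else if i = 2 then n + 1 else i - 2

/-- The order `n, n+1, 0, …, n-1` of the numbers `0, …, n+1`. -/
def evenOrder (n : ℕ) (i : ℕ) : ℕ :=
  if i = 0 then n else if i = 1 then n + 1 else i - 2

theorem oddOrder_le (n i : ℕ) (h : i ≤ n + 1) : oddOrder n i ≤ n + 1 := by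
  unfold oddOrder
  split_ifs <;> omega

theorem evenOrder_le (n i : ℕ) (h : i ≤ n + 1) : evenOrder n i ≤ n + 1 := by
  unfold evenOrder
  split_ifs <;> omega

end Supermap

end

/-! Everything is expressed through the bilinear pairing `pair x y = Tr(xᵀ y)`. The entries of
`choiMap X a` are the pairings of the slices of `X` with `a`, and its trace is the pairing of `a`
with the partial trace of `X`. Complete positivity on a block-diagonal algebra amounts to `X ≥ 0`.

If `J` contains the unit and is closed under the adjoint, then `J ∩ c𝔖` spans `J`. Hence a positive
`X` sends `J ∩ c𝔖` into states exactly when its partial trace differs from `c⁻¹ I` by an element of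
`J^⊥`; this is the subspace condition `S X ∈ J̃` together with one normalization of the trace
(`supermap_step`). Induction gives `C = Jₙ ∩ cₙ𝔖` with `Jₙ₊₁ = S⁻¹(J̃ₙ)` (`C_eq`). The two-step
recursion defining `Jsp` agrees with this one because the tilde of `S⁻¹(J̃)` is `S*(J)`
(`tilde_inf_comap_tilde`), a consequence of the bipolar identity `perp_perp` and of `tilde_tilde`.

Differences of equivalent elements span `N = Bₙ ⊗ Jₙ₋₁^⊥`: a hermitian `D ∈ N` is, up to scaling,
the difference of the equivalent elements proportional to `r I + D` and `r I`. So respecting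
equivalence means that `choiMap X` vanishes on `N`, and by bipolarity this says `X ∈ Bₙ₊₁ ⊗ Bₙ ⊗
Jₙ₋₁` (`respecting_eq`).

For `K` the full state space, reordering the factors turns this last condition into membership in
the space `J'ₙ₊₁` of the reordered sequence, for operators whose partial trace has the form `I ⊗ W`.
The proof peels off two factors at a time, slice by slice (`submatrix_mem_Jsp_step`), down to two
base cases according to parity. -/

noncomputable section

namespace Supermap

open Matrix

/-! ### Bilinear orthogonality, the bipolar identity and the tilde operation. -/

section Generic

variable {ι κ β γ : Type}

/-- The bilinear pairing `Tr(xᵀ y)` of matrices. -/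
def pair [Fintype κ] (x : Matrix κ κ ℂ) : Matrix κ κ ℂ →ₗ[ℂ] ℂ where
  toFun y := ∑ p, ∑ q, x p q * y p q
  map_add' y z := by simp [mul_add, Finset.sum_add_distrib]
  map_smul' a y := by simp [Finset.mul_sum, mul_left_comm]

theorem pair_apply [Fintype κ] (x y : Matrix κ κ ℂ) : pair x y = ∑ p, ∑ q, x p q * y p q := rfl

theorem pair_comm [Fintype κ] (x y : Matrix κ κ ℂ) : pair x y = pair y x := by
  simp [pair_apply, mul_comm]

theorem pair_one [Fintype κ] [DecidableEq κ] (x : Matrix κ κ ℂ) : pair 1 x = x.trace := by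
  simp [pair_apply, one_apply, trace]

theorem pair_conjTranspose [Fintype κ] (x y : Matrix κ κ ℂ) :
    pair xᴴ yᴴ = star (pair x y) := by
  simp only [pair_apply, conjTranspose_apply, star_sum, star_mul']
  exact Finset.sum_comm

theorem trace_conjTranspose_transpose_mul [Fintype κ] (a x : Matrix κ κ ℂ) :
    ((aᵀ)ᴴ * x).trace = pair aᴴ x := by
  simp only [trace, diag_apply, mul_apply, pair_apply, conjTranspose_apply, transpose_apply]
  exact Finset.sum_comm

/-- The matrices that are block-diagonal with respect to the labelling `l` of the basis. -/
def blk (l : κ → β) : Submodule ℂ (Matrix κ κ ℂ) where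
  carrier := {M | ∀ x y, l x ≠ l y → M x y = 0}
  add_mem' := by
    intro M N hM hN x y h
    simp [hM x y h, hN x y h]
  zero_mem' := by
    intro x y _
    rfl
  smul_mem' := by
    intro c M hM x y h
    simp [hM x y h]

theorem mem_blk {l : κ → β} {M : Matrix κ κ ℂ} :
    M ∈ blk l ↔ ∀ x y, l x ≠ l y → M x y = 0 := Iff.rfl

theorem one_mem_blk [DecidableEq κ] (l : κ → β) : (1 : Matrix κ κ ℂ) ∈ blk l := by
  intro x y h
  exact one_apply_ne fun e => h (congrArg l e)

theorem conjTranspose_mem_blk {l : κ → β} {M : Matrix κ κ ℂ} (h : M ∈ blk l) : Mᴴ ∈ blk l := by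
  intro x y hxy
  rw [conjTranspose_apply, h y x hxy.symm, star_zero]

/-- A subspace `J ⊆ A` that contains the unit and is closed under the adjoint. -/
structure IsOpSystem [DecidableEq κ] (A J : Submodule ℂ (Matrix κ κ ℂ)) : Prop where
  le : J ≤ A
  one_mem : 1 ∈ J
  star_mem : ∀ x ∈ J, xᴴ ∈ J

theorem isOpSystem_blk [DecidableEq κ] (l : κ → β) : IsOpSystem (blk l) (blk l) :=
  ⟨le_rfl, one_mem_blk l, fun _ => conjTranspose_mem_blk⟩

/-- The orthogonal complement of `J` in `A` for the bilinear pairing. -/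
def perp [Fintype κ] (A J : Submodule ℂ (Matrix κ κ ℂ)) : Submodule ℂ (Matrix κ κ ℂ) where
  carrier := {x | x ∈ A ∧ ∀ a ∈ J, pair a x = 0}
  add_mem' hx hy := ⟨add_mem hx.1 hy.1, fun a ha => by rw [map_add, hx.2 a ha, hy.2 a ha, add_zero]⟩
  zero_mem' := ⟨zero_mem _, fun _ _ => map_zero _⟩
  smul_mem' c x hx := ⟨A.smul_mem c hx.1, fun a ha => by rw [map_smul, hx.2 a ha, smul_zero]⟩

theorem mem_perp [Fintype κ] {A J : Submodule ℂ (Matrix κ κ ℂ)} {x : Matrix κ κ ℂ} :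
    x ∈ perp A J ↔ x ∈ A ∧ ∀ a ∈ J, pair a x = 0 := Iff.rfl

theorem conjTranspose_mem_perp [Fintype κ] {A J : Submodule ℂ (Matrix κ κ ℂ)}
    (hA : ∀ x ∈ A, xᴴ ∈ A) (hJ : ∀ x ∈ J, xᴴ ∈ J) {x : Matrix κ κ ℂ} (hx : x ∈ perp A J) :
    xᴴ ∈ perp A J := by
  refine ⟨hA x hx.1, fun a ha => ?_⟩
  rw [← conjTranspose_conjTranspose a, pair_conjTranspose, hx.2 _ (hJ a ha), star_zero]

/-- The pairing is nondegenerate on `blk l`: a functional separating `x` from `J` is represented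
there by the matrix `F` of its values on matrix units, cut down to the blocks. -/
theorem perp_perp [Fintype κ] [DecidableEq κ] {l : κ → β} {J : Submodule ℂ (Matrix κ κ ℂ)}
    (hJ : J ≤ blk l) : perp (blk l) (perp (blk l) J) = J := by
  classical
  apply le_antisymm
  · intro x hx
    by_contra hxJ
    obtain ⟨f, hfx, hfJ⟩ := Submodule.exists_le_ker_of_notMem hxJ
    let F : Matrix κ κ ℂ := of fun p q => if l p = l q then f (single p q 1) else 0
    have hF : ∀ y ∈ blk l, pair F y = f y := by
      intro y hy
      conv_rhs => rw [matrix_eq_sum_single y]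
      simp only [map_sum, pair_apply, F, of_apply]
      refine Finset.sum_congr rfl fun p _ => Finset.sum_congr rfl fun q _ => ?_
      split_ifs with h
      · rw [← mul_one (y p q), ← smul_eq_mul (y p q) 1, ← smul_single, map_smul]
        simp [mul_comm]
      · rw [hy p q h]
        simp
    have hFp : F ∈ perp (blk l) J := by
      refine ⟨fun p q h => by simp [F, h], fun a ha => ?_⟩
      rw [pair_comm, hF a (hJ ha)]
      exact hfJ ha
    exact hfx (by rw [← hF x hx.1]; exact hx.2 F hFp)
  · intro x hx
    refine ⟨hJ hx, fun a ha => ?_⟩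
    rw [pair_comm]
    exact ha.2 x hx

theorem perp_self [Fintype κ] [DecidableEq κ] (l : κ → β) : perp (blk l) (blk l) = ⊥ := by
  have h : perp (blk l) ⊥ = blk l := by
    ext x
    simp [mem_perp, pair_comm _ x]
  rw [← perp_perp (l := l) bot_le, h]

/-- The transpose and adjoint in the definition of `tilde` combine to an entrywise conjugation that
`J`, being closed under the adjoint, absorbs; so the bilinear complement may be used. The choice `x
= 0` puts the unit in the span. -/
theorem tilde_eq [Fintype κ] [DecidableEq κ] {A J : Submodule ℂ (Matrix κ κ ℂ)}
    (hJ : IsOpSystem A J) : tilde A J = Submodule.span ℂ {1} ⊔ perp A J := by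
  have key : ∀ x, (∀ a ∈ J, ((a.transpose).conjTranspose * x).trace = 0) ↔
      ∀ a ∈ J, pair a x = 0 := by
    intro x
    simp only [trace_conjTranspose_transpose_mul]
    refine ⟨fun h a ha => ?_, fun h a ha => h _ (hJ.star_mem a ha)⟩
    rw [← conjTranspose_conjTranspose a]
    exact h _ (hJ.star_mem a ha)
  apply le_antisymm
  · refine Submodule.span_le.2 ?_
    rintro _ ⟨x, hx, hxJ, rfl⟩
    exact add_mem (Submodule.mem_sup_left (Submodule.mem_span_singleton_self _))
      (Submodule.mem_sup_right ⟨hx, (key x).1 hxJ⟩)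
  · have h1 : (1 : Matrix κ κ ℂ) ∈ tilde A J :=
      Submodule.subset_span ⟨0, zero_mem _, by simp, by simp⟩
    refine sup_le ((Submodule.span_singleton_le_iff_mem _ _).2 h1) fun x hx => ?_
    have h2 : 1 + x ∈ tilde A J := Submodule.subset_span ⟨x, hx.1, (key x).2 hx.2, rfl⟩
    simpa using sub_mem h2 h1

theorem mem_tilde [Fintype κ] [DecidableEq κ] {A J : Submodule ℂ (Matrix κ κ ℂ)}
    (hJ : IsOpSystem A J) {x : Matrix κ κ ℂ} :
    x ∈ tilde A J ↔ ∃ r : ℂ, x - r • 1 ∈ perp A J := by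
  rw [tilde_eq hJ, Submodule.mem_sup]
  constructor
  · rintro ⟨y, hy, z, hz, rfl⟩
    obtain ⟨r, rfl⟩ := Submodule.mem_span_singleton.1 hy
    exact ⟨r, by simpa using hz⟩
  · rintro ⟨r, hr⟩
    exact ⟨r • 1, Submodule.mem_span_singleton.2 ⟨r, rfl⟩, _, hr, by simp⟩

theorem tilde_self [Fintype κ] [DecidableEq κ] (l : κ → β) :
    tilde (blk l) (blk l) = Submodule.span ℂ {1} := by
  rw [tilde_eq (isOpSystem_blk l), perp_self, sup_bot_eq]

theorem isOpSystem_tilde [Fintype κ] [DecidableEq κ] {l : κ → β}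
    {J : Submodule ℂ (Matrix κ κ ℂ)} (hJ : IsOpSystem (blk l) J) :
    IsOpSystem (blk l) (tilde (blk l) J) := by
  refine ⟨fun x hx => ?_, (mem_tilde hJ).2 ⟨1, by simp⟩, fun x hx => ?_⟩
  · obtain ⟨r, hr⟩ := (mem_tilde hJ).1 hx
    simpa using add_mem hr.1 ((blk l).smul_mem r (one_mem_blk l))
  · obtain ⟨r, hr⟩ := (mem_tilde hJ).1 hx
    refine (mem_tilde hJ).2 ⟨star r, ?_⟩
    simpa using conjTranspose_mem_perp (fun _ => conjTranspose_mem_blk) hJ.star_mem hr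

theorem trace_one_ne_zero [Fintype κ] [DecidableEq κ] [Nonempty κ] :
    (1 : Matrix κ κ ℂ).trace ≠ 0 := by
  simp [trace_one]

theorem trace_one_pos [Fintype κ] [DecidableEq κ] [Nonempty κ] :
    0 < (1 : Matrix κ κ ℂ).trace := by
  rw [trace_one]
  exact_mod_cast Fintype.card_pos

theorem tilde_tilde [Fintype κ] [DecidableEq κ] [Nonempty κ] {l : κ → β}
    {J : Submodule ℂ (Matrix κ κ ℂ)} (hJ : IsOpSystem (blk l) J) :
    tilde (blk l) (tilde (blk l) J) = J := by
  -- Orthogonality to the unit is tracelessness and orthogonality to `J^⊥` is membership in `J`;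
  -- adjoining the unit to the traceless part then recovers `J`.
  have hp : ∀ x, x ∈ perp (blk l) (tilde (blk l) J) ↔ x ∈ J ∧ x.trace = 0 := by
    intro x
    rw [← pair_one]
    constructor
    · intro hx
      refine ⟨?_, hx.2 1 (isOpSystem_tilde hJ).one_mem⟩
      rw [← perp_perp hJ.le]
      exact ⟨hx.1, fun a ha => hx.2 a ((mem_tilde hJ).2 ⟨0, by simpa using ha⟩)⟩
    · rintro ⟨hx, hx1⟩
      refine ⟨hJ.le hx, fun a ha => ?_⟩
      obtain ⟨r, hr⟩ := (mem_tilde hJ).1 ha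
      have := hr.2 x hx
      rw [pair_comm] at hx1
      rw [map_sub, map_smul, hx1, smul_zero, sub_zero] at this
      rw [pair_comm, this]
  ext x
  rw [mem_tilde (isOpSystem_tilde hJ)]
  constructor
  · rintro ⟨r, hr⟩
    simpa using add_mem ((hp _).1 hr).1 (J.smul_mem r hJ.one_mem)
  · intro hx
    refine ⟨x.trace / (1 : Matrix κ κ ℂ).trace, (hp _).2
      ⟨sub_mem hx (J.smul_mem _ hJ.one_mem), ?_⟩⟩
    rw [trace_sub, trace_smul, smul_eq_mul, div_mul_cancel₀ _ trace_one_ne_zero, sub_self]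

/-! ### Positivity -/

theorem exists_smul_one_add_posSemidef [Fintype κ] [DecidableEq κ] {h : Matrix κ κ ℂ}
    (hh : h.IsHermitian) : ∃ r : ℂ, 0 < r ∧ (r • 1 + h).PosSemidef := by
  obtain ⟨s, hs⟩ : ∃ s : ℝ, ∀ i, -hh.eigenvalues i ≤ s := by
    obtain ⟨s, hs⟩ := (Set.finite_range fun i => -hh.eigenvalues i).bddAbove
    exact ⟨s, fun i => hs ⟨i, rfl⟩⟩
  -- `s` makes the shifted eigenvalues nonnegative; the maximum with `1` only secures `r > 0`.
  refine ⟨((max s 1 : ℝ) : ℂ), by simp, ?_⟩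
  let U : Matrix κ κ ℂ := hh.eigenvectorUnitary
  have hU : U * Uᴴ = 1 := Unitary.mul_star_self_of_mem hh.eigenvectorUnitary.2
  have hsp : h = U * diagonal (fun i => (hh.eigenvalues i : ℂ)) * Uᴴ := by
    conv_lhs => rw [hh.spectral_theorem]
    rfl
  have : ((max s 1 : ℝ) : ℂ) • 1 + h =
      U * diagonal (fun i => ((max s 1 + hh.eigenvalues i : ℝ) : ℂ)) * Uᴴ := by
    have e : diagonal (fun i => ((max s 1 + hh.eigenvalues i : ℝ) : ℂ)) =
        ((max s 1 : ℝ) : ℂ) • (1 : Matrix κ κ ℂ) +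
          diagonal (fun i => (hh.eigenvalues i : ℂ)) := by
      ext i j
      by_cases hij : i = j
      · subst hij; simp
      · simp [hij]
    rw [e, Matrix.mul_add, Matrix.add_mul, ← hsp, Matrix.mul_smul, Matrix.mul_one,
      Matrix.smul_mul, hU]
  rw [this]
  refine (PosSemidef.diagonal fun i => ?_).mul_mul_conjTranspose_same U
  have := hs i
  have h2 := le_max_left s 1
  simp only [Pi.zero_apply]
  exact_mod_cast (by linarith : (0 : ℝ) ≤ max s 1 + hh.eigenvalues i)

theorem mem_smul_states [Fintype κ] [DecidableEq κ] {A : Submodule ℂ (Matrix κ κ ℂ)} {c : ℂ}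
    (hc : 0 < c) {x : Matrix κ κ ℂ} :
    x ∈ c • states A ↔ x ∈ A ∧ x.PosSemidef ∧ x.trace = c := by
  rw [Set.mem_smul_set_iff_inv_smul_mem₀ hc.ne']
  have hi : 0 < c⁻¹ := by simpa using hc
  constructor
  · rintro ⟨h1, h2, h3⟩
    have e : x = c • (c⁻¹ • x) := by rw [smul_inv_smul₀ hc.ne']
    refine ⟨?_, ?_, ?_⟩
    · rw [e]; exact A.smul_mem c h1
    · rw [e]; exact h2.smul hc.le
    · rw [e, trace_smul, h3, smul_eq_mul, mul_one]
  · rintro ⟨h1, h2, h3⟩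
    exact ⟨A.smul_mem _ h1, h2.smul hi.le, by
      rw [trace_smul, h3, smul_eq_mul, inv_mul_cancel₀ hc.ne']⟩

theorem smul_mem_inter_smul_states [Fintype κ] [DecidableEq κ] [Nonempty κ]
    {A J : Submodule ℂ (Matrix κ κ ℂ)} (hJ : IsOpSystem A J) {c : ℂ} (hc : 0 < c)
    {h : Matrix κ κ ℂ} (hh : h ∈ J) (hpos : h.PosSemidef) (htr : 0 < h.trace) :
    (c / h.trace) • h ∈ (J : Set (Matrix κ κ ℂ)) ∩ c • states A := by
  have hcd : 0 < c / h.trace := by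
    have : 0 < (h.trace)⁻¹ := by simpa using htr
    rw [div_eq_mul_inv]; exact mul_pos hc this
  refine ⟨J.smul_mem _ hh, (mem_smul_states hc).2 ⟨A.smul_mem _ (hJ.le hh), hpos.smul hcd.le, ?_⟩⟩
  rw [trace_smul, smul_eq_mul, div_mul_cancel₀ _ htr.ne']

/-- A subspace closed under the adjoint is contained in `P` if its hermitian elements are. -/
theorem le_of_isHermitian {J P : Submodule ℂ (Matrix κ κ ℂ)} (hJ : ∀ x ∈ J, xᴴ ∈ J)
    (h : ∀ x ∈ J, x.IsHermitian → x ∈ P) : J ≤ P := by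
  intro x hx
  have h1 : x + xᴴ ∈ P := by
    refine h _ (add_mem hx (hJ x hx)) ?_
    simp [IsHermitian, add_comm]
  have h2 : Complex.I • (x - xᴴ) ∈ P := by
    refine h _ (J.smul_mem _ (sub_mem hx (hJ x hx))) ?_
    ext i j
    simp
    ring
  have e : x = (2⁻¹ : ℂ) • ((x + xᴴ) + (-Complex.I) • (Complex.I • (x - xᴴ))) := by
    rw [smul_smul]
    simp only [neg_mul, Complex.I_mul_I, neg_neg, one_smul]
    ext i j
    simp
    ring
  rw [e]
  exact P.smul_mem _ (add_mem h1 (P.smul_mem _ h2))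

/-- A hermitian element is a difference of positive elements of `J`, one of them a multiple of the
unit, and positive elements of nonzero trace rescale into `c • states A`. -/
theorem span_inter_smul_states [Fintype κ] [DecidableEq κ] [Nonempty κ]
    {A J : Submodule ℂ (Matrix κ κ ℂ)} (hJ : IsOpSystem A J) {c : ℂ} (hc : 0 < c) :
    Submodule.span ℂ ((J : Set (Matrix κ κ ℂ)) ∩ c • states A) = J := by
  apply le_antisymm
  · exact Submodule.span_le.2 fun x hx => hx.1
  set T := Submodule.span ℂ ((J : Set (Matrix κ κ ℂ)) ∩ c • states A)
  have hT : ∀ h ∈ J, h.PosSemidef → 0 < h.trace → h ∈ T := by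
    intro h hh hp ht
    have := T.smul_mem (h.trace / c) (Submodule.subset_span (smul_mem_inter_smul_states hJ hc hh hp ht))
    rwa [smul_smul, div_mul_div_cancel₀ hc.ne', div_self ht.ne', one_smul] at this
  have h1 : (1 : Matrix κ κ ℂ) ∈ T := hT 1 hJ.one_mem PosSemidef.one trace_one_pos
  refine le_of_isHermitian hJ.star_mem fun x hx hxh => ?_
  obtain ⟨r, hr, hp⟩ := exists_smul_one_add_posSemidef hxh
  -- Since `r • 1 + x` could vanish, one more unit is added to make the trace strictly positive.
  have hp' := hp.add (PosSemidef.one (n := κ) (R := ℂ))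
  have : r • 1 + x + 1 ∈ T := by
    refine hT _ (add_mem (add_mem (J.smul_mem r hJ.one_mem) hx) hJ.one_mem) hp' ?_
    rw [trace_add]
    exact lt_of_lt_of_le trace_one_pos (le_add_of_nonneg_left hp.trace_nonneg)
  have := sub_mem (sub_mem this h1) (T.smul_mem r h1)
  simpa using this

/-! ### Slices -/

/-- The component of `X` at the matrix unit `E i j` of the left factor. -/
def slice (i j : ι) : Matrix (ι × κ) (ι × κ) ℂ →ₗ[ℂ] Matrix κ κ ℂ where
  toFun X := of fun x y => X (i, x) (j, y)
  map_add' _ _ := rfl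
  map_smul' _ _ := rfl

theorem slice_apply (i j : ι) (X : Matrix (ι × κ) (ι × κ) ℂ) (x y : κ) :
    slice i j X x y = X (i, x) (j, y) := rfl

theorem slice_ext {X Y : Matrix (ι × κ) (ι × κ) ℂ} (h : ∀ i j, slice i j X = slice i j Y) :
    X = Y := by
  ext ⟨i, x⟩ ⟨j, y⟩
  exact congrFun (congrFun (h i j) x) y

theorem slice_conjTranspose (i j : ι) (X : Matrix (ι × κ) (ι × κ) ℂ) :
    slice i j Xᴴ = (slice j i X)ᴴ := rfl

theorem slice_kronecker (a : Matrix ι ι ℂ) (b : Matrix κ κ ℂ) (i j : ι) :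
    slice i j (a ⊗ₖ b) = a i j • b := rfl

theorem trLeft_eq_sum [Fintype ι] (X : Matrix (ι × κ) (ι × κ) ℂ) :
    trLeft X = ∑ i, slice i i X := by
  ext x y
  rw [Matrix.sum_apply]
  rfl

theorem slice_trLeftAdj [DecidableEq ι] (b : Matrix κ κ ℂ) (i j : ι) :
    slice i j (trLeftAdj b : Matrix (ι × κ) (ι × κ) ℂ) = (1 : Matrix ι ι ℂ) i j • b := rfl

theorem trLeft_trLeftAdj [Fintype ι] [DecidableEq ι] (b : Matrix κ κ ℂ) :
    trLeft (trLeftAdj b : Matrix (ι × κ) (ι × κ) ℂ) = (1 : Matrix ι ι ℂ).trace • b := by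
  rw [trLeft_eq_sum]
  simp only [slice_trLeftAdj]
  rw [← Finset.sum_smul]
  rfl

theorem trace_trLeft [Fintype ι] [Fintype κ] (X : Matrix (ι × κ) (ι × κ) ℂ) :
    (trLeft X).trace = X.trace := by
  simp only [trace, diag_apply, trLeft, LinearMap.coe_mk, AddHom.coe_mk, of_apply,
    Fintype.sum_prod_type]
  exact Finset.sum_comm

theorem trLeft_conjTranspose [Fintype ι] (X : Matrix (ι × κ) (ι × κ) ℂ) :
    trLeft Xᴴ = (trLeft X)ᴴ := by
  simp [trLeft_eq_sum, slice_conjTranspose, conjTranspose_sum]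

theorem pair_eq_sum_slice [Fintype ι] [Fintype κ] (X Y : Matrix (ι × κ) (ι × κ) ℂ) :
    pair X Y = ∑ i, ∑ j, pair (slice i j X) (slice i j Y) := by
  simp only [pair_apply, Fintype.sum_prod_type, slice_apply]
  exact Finset.sum_congr rfl fun i _ => Finset.sum_comm

theorem pair_trLeftAdj [Fintype ι] [Fintype κ] [DecidableEq ι] (b : Matrix κ κ ℂ)
    (X : Matrix (ι × κ) (ι × κ) ℂ) : pair (trLeftAdj b) X = pair b (trLeft X) := by
  rw [pair_eq_sum_slice, trLeft_eq_sum, map_sum]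
  refine Finset.sum_congr rfl fun i _ => ?_
  rw [Finset.sum_eq_single i]
  · rw [slice_trLeftAdj, one_apply_eq, one_smul]
  · intro j _ hj
    rw [slice_trLeftAdj, one_apply_ne hj.symm, zero_smul, pair_comm, map_zero]
  · simp

theorem choiMap_apply [Fintype ι] [Fintype κ] [DecidableEq ι] [DecidableEq κ]
    (X : Matrix (ι × κ) (ι × κ) ℂ) (a : Matrix κ κ ℂ) (i j : ι) :
    choiMap X a i j = pair (slice i j X) a := by
  simp only [choiMap, trRight, LinearMap.coe_mk, AddHom.coe_mk, of_apply, mul_apply,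
    Fintype.sum_prod_type, kroneckerMap_apply, one_apply, transpose_apply, pair_apply, slice_apply]
  rw [Finset.sum_comm]
  simp only [ite_mul, one_mul, zero_mul, Finset.sum_ite_irrel, Finset.sum_const_zero]
  rw [Finset.sum_eq_single i (by intro b _ hb; simp [hb.symm]) (by simp)]
  simp only [if_true]
  rw [Finset.sum_comm]
  exact Finset.sum_congr rfl fun p _ => Finset.sum_congr rfl fun q _ => mul_comm _ _

theorem trace_choiMap [Fintype ι] [Fintype κ] [DecidableEq ι] [DecidableEq κ]
    (X : Matrix (ι × κ) (ι × κ) ℂ) (a : Matrix κ κ ℂ) :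
    (choiMap X a).trace = pair a (trLeft X) := by
  simp only [trace, diag_apply, choiMap_apply, trLeft_eq_sum, map_sum]
  exact Finset.sum_congr rfl fun i _ => pair_comm _ _

theorem mem_tensor_blk [Fintype ι] [DecidableEq ι] {l : ι → γ} {M : Submodule ℂ (Matrix κ κ ℂ)}
    {X : Matrix (ι × κ) (ι × κ) ℂ} :
    X ∈ tensor (blk l) M ↔
      (∀ i j, slice i j X ∈ M) ∧ ∀ i j, l i ≠ l j → slice i j X = 0 := by
  constructor
  · intro hX
    refine Submodule.span_induction ?_ ?_ ?_ ?_ hX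
    · rintro _ ⟨a, ha, b, hb, rfl⟩
      refine ⟨fun i j => by rw [slice_kronecker]; exact M.smul_mem _ hb, fun i j h => ?_⟩
      rw [slice_kronecker, ha i j h, zero_smul]
    · exact ⟨fun i j => by rw [map_zero]; exact M.zero_mem, fun i j _ => map_zero _⟩
    · rintro x y - - hx hy
      exact ⟨fun i j => by rw [map_add]; exact add_mem (hx.1 i j) (hy.1 i j), fun i j h => by
        rw [map_add, hx.2 i j h, hy.2 i j h, add_zero]⟩
    · rintro c x - hx
      exact ⟨fun i j => by rw [map_smul]; exact M.smul_mem _ (hx.1 i j), fun i j h => by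
        rw [map_smul, hx.2 i j h, smul_zero]⟩
  · rintro ⟨h1, h2⟩
    have e : X = ∑ i, ∑ j, (single i j (1 : ℂ)) ⊗ₖ slice i j X := by
      refine slice_ext fun p q => ?_
      simp only [map_sum, slice_kronecker]
      rw [Finset.sum_eq_single p, Finset.sum_eq_single q]
      · simp
      · intro b _ hb
        simp [hb]
      · simp
      · intro b _ hb
        simp [hb]
      · simp
    rw [e]
    refine Submodule.sum_mem _ fun i _ => Submodule.sum_mem _ fun j _ => ?_
    by_cases h : l i = l j
    · refine Submodule.subset_span ⟨_, fun p q hpq => ?_, _, h1 i j, rfl⟩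
      rw [single_apply, if_neg]
      rintro ⟨rfl, rfl⟩
      exact hpq h
    · rw [h2 i j h, kronecker_zero]
      exact zero_mem _

theorem tensor_blk_blk [Fintype ι] [DecidableEq ι] (l : ι → γ) (l' : κ → β) :
    tensor (blk l) (blk l') = blk fun x : ι × κ => (l x.1, l' x.2) := by
  ext X
  rw [mem_tensor_blk]
  constructor
  · rintro ⟨h1, h2⟩ ⟨i, x⟩ ⟨j, y⟩ h
    by_cases hij : l i = l j
    · exact h1 i j x y fun hxy => h (by simp [hij, hxy])
    · exact congrFun (congrFun (h2 i j hij) x) y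
  · intro h
    exact ⟨fun i j x y hxy => h _ _ (by simp [hxy]), fun i j hij => by
      ext x y
      exact h _ _ (by simp [hij])⟩

/-! ### Complete positivity -/

theorem comp_map_choiMap_posSemidef [Fintype ι] [Fintype κ] [DecidableEq ι] [DecidableEq κ]
    {X : Matrix (ι × κ) (ι × κ) ℂ} (hX : X.PosSemidef) {δ : Type} [Fintype δ] [DecidableEq δ]
    {M : Matrix δ δ (Matrix κ κ ℂ)} (hM : (comp δ δ κ κ ℂ M).PosSemidef) :
    (comp δ δ ι ι ℂ (M.map (choiMap X))).PosSemidef := by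
  let Z : Matrix ((δ × ι) × κ) ((δ × ι) × κ) ℂ :=
    (X.submatrix (fun u => (u.1.2, u.2)) (fun u => (u.1.2, u.2))) ⊙
      ((comp δ δ κ κ ℂ M).submatrix (fun u => (u.1.1, u.2)) (fun u => (u.1.1, u.2)))
  -- Schur product theorem for `X` and `M`, both blown up to the common index set; summing over `κ`,
  -- which is compression by `W`, yields the Choi map applied blockwise.
  have hZ : Z.PosSemidef := (hX.submatrix _).hadamard (hM.submatrix _)
  let W : Matrix ((δ × ι) × κ) (δ × ι) ℂ := of fun u v => if u.1 = v then 1 else 0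
  have e : comp δ δ ι ι ℂ (M.map (choiMap X)) = Wᴴ * Z * W := by
    have h1 : ∀ u t, (Wᴴ * Z) u t = ∑ y, Z (u, y) t := by
      intro u t
      simp only [mul_apply, conjTranspose_apply, W, of_apply]
      rw [Fintype.sum_prod_type, Finset.sum_eq_single u]
      · simp
      · intro b _ hb
        simp [hb]
      · simp
    ext u v
    rw [mul_apply, Fintype.sum_prod_type, Finset.sum_eq_single v]
    · simp only [h1, W, of_apply, if_true, mul_one]
      rw [Finset.sum_comm]
      exact choiMap_apply X (M u.1 v.1) u.2 v.2
    · intro b _ hb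
      simp [W, hb]
    · simp
  rw [e]
  exact hZ.conjTranspose_mul_mul_same W

/-- Choi's theorem for a block-diagonal domain. The usual test matrix has matrix units outside the
blocks as entries and is not admissible, so only those within a block are kept. The result is a sum
of rank-one matrices, one per block, and still recovers `X`, whose remaining entries vanish. -/
theorem isCPOn_choiMap_iff [Fintype ι] [Fintype κ] [DecidableEq ι] [DecidableEq κ]
    {l : ι → γ} {l' : κ → β} [DecidableEq β] {X : Matrix (ι × κ) (ι × κ) ℂ}
    (hX : X ∈ tensor (blk l) (blk l')) :
    IsCPOn (blk l') (choiMap X) ↔ X.PosSemidef := by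
  constructor
  · intro h
    let f := Fintype.equivFin κ
    let M : Matrix (Fin (Fintype.card κ)) (Fin (Fintype.card κ)) (Matrix κ κ ℂ) :=
      of fun p q => of fun x y => if f x = p ∧ f y = q ∧ l' x = l' y then 1 else 0
    -- One column per block; columns are indexed by the range of `l'` because the label type itself
    -- may be infinite.
    let W : Matrix (Fin (Fintype.card κ) × κ) (Set.range l') ℂ :=
      of fun u c => if f u.2 = u.1 ∧ l' u.2 = c.1 then 1 else 0
    have hM : (comp _ _ κ κ ℂ M).PosSemidef := by
      have e : comp _ _ κ κ ℂ M = W * Wᴴ := by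
        ext ⟨p, x⟩ ⟨q, y⟩
        rw [mul_apply, Finset.sum_eq_single (⟨l' x, x, rfl⟩ : Set.range l')]
        · by_cases h3 : l' x = l' y
          · by_cases h1 : f x = p <;> by_cases h2 : f y = q <;> simp [M, W, h1, h2, ← h3]
          · simp [M, W, h3, Ne.symm h3]
        · intro c _ hc
          have : l' x ≠ c.1 := fun e => hc (Subtype.ext e.symm)
          simp [W, this]
        · simp
      rw [e]
      exact posSemidef_self_mul_conjTranspose W
    have key := h _ M (fun p q x y hxy => by simp [M, hxy]) hM
    have e : X = (comp _ _ ι ι ℂ (M.map (choiMap X))).submatrix (fun u => (f u.2, u.1))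
        (fun u => (f u.2, u.1)) := by
      ext ⟨i, x⟩ ⟨j, y⟩
      change X (i, x) (j, y) = choiMap X (M (f x) (f y)) i j
      rw [choiMap_apply, pair_apply, Finset.sum_eq_single x, Finset.sum_eq_single y]
      · by_cases hxy : l' x = l' y
        · simp [M, hxy, slice_apply]
        · have h0 : X (i, x) (j, y) = 0 := (mem_tensor_blk.1 hX).1 i j x y hxy
          simp [slice_apply, h0]
      · intro b _ hb
        simp [M, hb]
      · simp
      · intro b _ hb
        simp [M, hb]
      · simp
    rw [e]
    exact key.submatrix _
  · intro h d M _ hM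
    exact comp_map_choiMap_posSemidef h hM

theorem choiMap_posSemidef [Fintype ι] [Fintype κ] [DecidableEq ι] [DecidableEq κ]
    {X : Matrix (ι × κ) (ι × κ) ℂ} (hX : X.PosSemidef) {a : Matrix κ κ ℂ} (ha : a.PosSemidef) :
    (choiMap X a).PosSemidef := by
  have h : (comp Unit Unit κ κ ℂ (of fun _ _ => a)).PosSemidef := ha.submatrix Prod.snd
  exact (comp_map_choiMap_posSemidef hX h).submatrix (fun i => ((), i))

end Generic

/-! ### Preimages under the partial trace and one step of the supermap construction. -/

section Generic

variable {ι κ β γ : Type}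

theorem trLeftAdj_one [DecidableEq ι] [DecidableEq κ] :
    (trLeftAdj (1 : Matrix κ κ ℂ) : Matrix (ι × κ) (ι × κ) ℂ) = 1 :=
  one_kronecker_one

theorem trLeftAdj_mem_tensor [DecidableEq ι] {l : ι → γ} {M : Submodule ℂ (Matrix κ κ ℂ)}
    {b : Matrix κ κ ℂ} (hb : b ∈ M) : trLeftAdj b ∈ tensor (blk l) M :=
  Submodule.subset_span ⟨1, one_mem_blk l, b, hb, rfl⟩

theorem trLeft_mem [Fintype ι] [DecidableEq ι] {l : ι → γ} {M : Submodule ℂ (Matrix κ κ ℂ)}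
    {X : Matrix (ι × κ) (ι × κ) ℂ} (hX : X ∈ tensor (blk l) M) : trLeft X ∈ M := by
  rw [trLeft_eq_sum]
  exact Submodule.sum_mem _ fun i _ => (mem_tensor_blk.1 hX).1 i i

theorem isOpSystem_inf_comap [Fintype ι] [DecidableEq ι] [DecidableEq κ] {l : ι → γ}
    {l' : κ → β} {T : Submodule ℂ (Matrix κ κ ℂ)} (hT : IsOpSystem (blk l') T) :
    IsOpSystem (tensor (blk l) (blk l')) (tensor (blk l) (blk l') ⊓ T.comap trLeft) := by
  refine ⟨inf_le_left, ⟨?_, ?_⟩, fun x hx => ⟨?_, ?_⟩⟩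
  · rw [tensor_blk_blk]
    exact one_mem_blk _
  · simp only [Submodule.comap_coe, Set.mem_preimage, SetLike.mem_coe]
    rw [← trLeftAdj_one, trLeft_trLeftAdj]
    exact T.smul_mem _ hT.one_mem
  · have := hx.1
    rw [tensor_blk_blk] at this ⊢
    exact conjTranspose_mem_blk this
  · simp only [Submodule.comap_coe, Set.mem_preimage, SetLike.mem_coe]
    rw [trLeft_conjTranspose]
    exact hT.star_mem _ hx.2

variable [Fintype ι] [Fintype κ] [DecidableEq ι] [DecidableEq κ]

/-- By adjointness and `T = T^⊥⊥`, the preimage of `T` is the complement of `S*(T^⊥)`; taking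
complements once more gives the claim. -/
theorem perp_inf_comap {l : ι → γ} {l' : κ → β} {T : Submodule ℂ (Matrix κ κ ℂ)}
    (hT : T ≤ blk l') :
    perp (tensor (blk l) (blk l')) (tensor (blk l) (blk l') ⊓ T.comap trLeft) =
      (perp (blk l') T).map (trLeftAdj : _ →ₗ[ℂ] Matrix (ι × κ) (ι × κ) ℂ) := by
  have h : tensor (blk l) (blk l') ⊓ T.comap trLeft = perp (tensor (blk l) (blk l'))
      ((perp (blk l') T).map (trLeftAdj : _ →ₗ[ℂ] Matrix (ι × κ) (ι × κ) ℂ)) := by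
    ext y
    rw [Submodule.mem_inf, mem_perp, Submodule.mem_comap]
    refine and_congr_right fun hy => ?_
    conv_lhs => rw [← perp_perp hT]
    rw [mem_perp]
    constructor
    · rintro ⟨-, h⟩ _ ⟨a, ha, rfl⟩
      rw [pair_trLeftAdj]
      exact h a ha
    · intro h
      refine ⟨trLeft_mem hy, fun a ha => ?_⟩
      rw [← pair_trLeftAdj (ι := ι)]
      exact h _ ⟨a, ha, rfl⟩
  have hle : (perp (blk l') T).map (trLeftAdj : _ →ₗ[ℂ] Matrix (ι × κ) (ι × κ) ℂ) ≤
      tensor (blk l) (blk l') := by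
    rintro _ ⟨a, ha, rfl⟩
    exact trLeftAdj_mem_tensor ha.1
  rw [h]
  rw [tensor_blk_blk] at hle ⊢
  exact perp_perp hle

/-- This explains the two-step recursion of `Jsp`: the complement of `S⁻¹(J̃)` is `S*(J̃^⊥)`, and
adjoining `I = S*(I)` produces `S*` of the double tilde, which is `J`. -/
theorem tilde_inf_comap_tilde [Nonempty κ] {l : ι → γ} {l' : κ → β}
    {J : Submodule ℂ (Matrix κ κ ℂ)} (hJ : IsOpSystem (blk l') J) :
    tilde (tensor (blk l) (blk l'))
        (tensor (blk l) (blk l') ⊓ (tilde (blk l') J).comap trLeft) =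
      J.map (trLeftAdj : _ →ₗ[ℂ] Matrix (ι × κ) (ι × κ) ℂ) := by
  have hT := isOpSystem_tilde hJ
  ext x
  rw [mem_tilde (isOpSystem_inf_comap hT), perp_inf_comap hT.le]
  constructor
  · rintro ⟨r, z, hz, hzx⟩
    refine ⟨z + r • 1, ?_, ?_⟩
    · rw [SetLike.mem_coe, ← tilde_tilde hJ]
      exact (mem_tilde hT).2 ⟨r, by simpa using hz⟩
    · rw [map_add, map_smul, trLeftAdj_one, hzx, sub_add_cancel]
  · rintro ⟨y, hy, rfl⟩
    rw [SetLike.mem_coe, ← tilde_tilde hJ] at hy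
    obtain ⟨r, hr⟩ := (mem_tilde hT).1 hy
    exact ⟨r, _, hr, by rw [map_sub, map_smul, trLeftAdj_one]⟩

/-- The completely positive maps sending `J ∩ c 𝔖` to states. -/
theorem supermap_step [DecidableEq β] [Nonempty κ] {l : ι → γ} {l' : κ → β}
    {J : Submodule ℂ (Matrix κ κ ℂ)} (hJ : IsOpSystem (blk l') J) {c c' : ℂ} (hc : 0 < c)
    (hc' : 0 < c') (hcc : c' * c = (1 : Matrix κ κ ℂ).trace) :
    {X : Matrix (ι × κ) (ι × κ) ℂ | X ∈ tensor (blk l) (blk l') ∧ IsCPOn (blk l') (choiMap X) ∧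
      ∀ Y ∈ (J : Set (Matrix κ κ ℂ)) ∩ c • states (blk l'), choiMap X Y ∈ states (blk l)} =
    ((tensor (blk l) (blk l') ⊓ (tilde (blk l') J).comap trLeft :
      Submodule ℂ (Matrix (ι × κ) (ι × κ) ℂ)) : Set (Matrix (ι × κ) (ι × κ) ℂ)) ∩
      c' • states (tensor (blk l) (blk l')) := by
  ext X
  simp only [Set.mem_ofPred_eq, Set.mem_inter_iff, mem_smul_states hc', SetLike.mem_coe,
    Submodule.mem_inf, Submodule.mem_comap]
  constructor
  · rintro ⟨hA, hcp, hst⟩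
    rw [isCPOn_choiMap_iff hA] at hcp
    -- On `J ∩ c𝔖` this is trace preservation; both sides are linear and that set spans `J`.
    have hz : ∀ a ∈ J, pair a (trLeft X) = c⁻¹ * a.trace := by
      have hle : J ≤ LinearMap.ker (pair (trLeft X) - c⁻¹ • pair (1 : Matrix κ κ ℂ)) := by
        rw [← span_inter_smul_states hJ hc]
        refine Submodule.span_le.2 fun Y hY => ?_
        have h1 := (hst Y hY).2.2
        have h2 := ((mem_smul_states hc).1 hY.2).2.2
        rw [trace_choiMap, pair_comm] at h1
        simp [h1, pair_one, h2, hc.ne']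
      intro a ha
      have := hle ha
      rw [LinearMap.mem_ker, LinearMap.sub_apply, LinearMap.smul_apply, pair_one,
        sub_eq_zero] at this
      rw [pair_comm, this, smul_eq_mul]
    refine ⟨⟨hA, (mem_tilde hJ).2 ⟨c⁻¹, ?_, fun a ha => ?_⟩⟩, hA, hcp, ?_⟩
    · exact sub_mem (trLeft_mem hA) (Submodule.smul_mem _ _ (one_mem_blk l'))
    · rw [map_sub, map_smul, hz a ha, pair_comm a 1, pair_one, smul_eq_mul, sub_self]
    · rw [← trace_trLeft, ← pair_one, hz 1 hJ.one_mem, ← hcc]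
      field_simp [hc.ne']
  · rintro ⟨⟨hA, hT⟩, -, hpos, htr⟩
    refine ⟨hA, (isCPOn_choiMap_iff hA).2 hpos, fun Y hY => ?_⟩
    have hY' := (mem_smul_states hc).1 hY.2
    refine ⟨fun i j hij => ?_, choiMap_posSemidef hpos hY'.2.1, ?_⟩
    · rw [choiMap_apply, (mem_tensor_blk.1 hA).2 i j hij, pair_comm, map_zero]
    -- Pairing with the unit determines the scalar, `c' = r (c' c)`; pairing with `Y` gives output
    -- trace `r c`, which is therefore `1`.
    · obtain ⟨r, hr⟩ := (mem_tilde hJ).1 hT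
      have h1 := hr.2 1 hJ.one_mem
      have h2 := hr.2 Y hY.1
      rw [map_sub, map_smul, pair_one, pair_one, trace_trLeft, htr, ← hcc, smul_eq_mul,
        sub_eq_zero] at h1
      rw [map_sub, map_smul, pair_comm Y 1, pair_one, hY'.2.2, smul_eq_mul, sub_eq_zero] at h2
      rw [trace_choiMap, h2]
      refine mul_left_cancel₀ hc'.ne' ?_
      rw [mul_one]
      exact (mul_left_comm _ _ _).trans h1.symm

end Generic

/-! ### The algebras `A B n` as block-diagonal matrices. -/

theorem FinDimCStar.alg_eq_blk (B : FinDimCStar) : B.alg = blk Sigma.fst := rfl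

instance (B : FinDimCStar) : Nonempty B.Idx :=
  ⟨⟨⟨0, B.blocks_pos⟩, ⟨0, B.dim_pos _⟩⟩⟩

instance TIdx.instNonempty (B : ℕ → FinDimCStar) : (n : ℕ) → Nonempty (TIdx B n)
  | 0 => inferInstanceAs (Nonempty (B 0).Idx)
  | n + 1 =>
    letI := TIdx.instNonempty B n
    inferInstanceAs (Nonempty ((B (n + 1)).Idx × TIdx B n))

/-- The block labels of a basis element of `Hₙ ⊗ ⋯ ⊗ H₀`. -/
def lab (B : ℕ → FinDimCStar) : (n : ℕ) → TIdx B n → List ℕ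
  | 0, x => [x.1.val]
  | n + 1, x => x.1.1.val :: lab B n x.2

theorem A_eq_blk (B : ℕ → FinDimCStar) (n : ℕ) : A B n = blk (lab B n) := by
  induction n with
  | zero =>
    ext X
    simp only [A, FinDimCStar.alg_eq_blk, mem_blk, lab]
    simp [Fin.ext_iff]
  | succ n ih =>
    rw [A, ih, FinDimCStar.alg_eq_blk, tensor_blk_blk]
    ext X
    simp only [mem_blk, lab]
    simp [Fin.ext_iff, Prod.ext_iff]

theorem A_succ (B : ℕ → FinDimCStar) (n : ℕ) :
    A B (n + 1) = tensor (blk Sigma.fst) (blk (lab B n)) := by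
  rw [A, A_eq_blk, FinDimCStar.alg_eq_blk]

/-! ### The subspaces `Jₙ` -/

theorem isOpSystem_span {A : Submodule ℂ (Matrix ι ι ℂ)} [Fintype ι] [DecidableEq ι]
    {K : Set (Matrix ι ι ℂ)} (hK : IsSection A K) {r : ℂ} (hr : r ≠ 0)
    (h1 : r • (1 : Matrix ι ι ℂ) ∈ K) : IsOpSystem A (Submodule.span ℂ K) := by
  have hst : K ⊆ states A := by
    rw [hK]
    exact Set.inter_subset_right
  refine ⟨Submodule.span_le.2 fun x hx => (hst hx).1, ?_, fun x hx => ?_⟩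
  · have := (Submodule.span ℂ K).smul_mem r⁻¹ (Submodule.subset_span h1)
    rwa [inv_smul_smul₀ hr] at this
  · refine Submodule.span_induction ?_ ?_ ?_ ?_ hx
    · intro x hx
      rw [(hst hx).2.1.isHermitian]
      exact Submodule.subset_span hx
    · simp
    · intro x y _ _ hx hy
      rw [conjTranspose_add]
      exact add_mem hx hy
    · intro a x _ hx
      rw [conjTranspose_smul]
      exact Submodule.smul_mem _ _ hx

section Jsp

variable (B : ℕ → FinDimCStar) {J : Submodule ℂ (Op B 0)}

/-- The two claims are carried together: computing the tilde of `Jₙ₊₁` as `S*(Jₙ)` needs both the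
one-step formula for `Jₙ₊₁` and the operator-system property of `Jₙ`. -/
theorem Jsp_aux (hJ : IsOpSystem (A B 0) J) (n : ℕ) :
    IsOpSystem (A B n) (Jsp B J n) ∧
      Jsp B J (n + 1) = A B (n + 1) ⊓ (tilde (A B n) (Jsp B J n)).comap trLeft := by
  induction n with
  | zero => exact ⟨hJ, rfl⟩
  | succ n ih =>
    obtain ⟨h1, h2⟩ := ih
    rw [h2]
    rw [A_eq_blk B n] at h1 ⊢
    rw [A_succ]
    refine ⟨isOpSystem_inf_comap (isOpSystem_tilde h1), ?_⟩
    rw [tilde_inf_comap_tilde h1]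
    rfl

theorem isOpSystem_Jsp (hJ : IsOpSystem (A B 0) J) (n : ℕ) : IsOpSystem (A B n) (Jsp B J n) :=
  (Jsp_aux B hJ n).1

theorem Jsp_succ (hJ : IsOpSystem (A B 0) J) (n : ℕ) :
    Jsp B J (n + 1) = A B (n + 1) ⊓ (tilde (A B n) (Jsp B J n)).comap trLeft :=
  (Jsp_aux B hJ n).2

end Jsp

/-! ### The normalizing constants and the closed form of `C`. -/

theorem FinDimCStar.t_pos (B : FinDimCStar) : 0 < B.t := trace_one_pos

theorem c_pos (B : ℕ → FinDimCStar) (n : ℕ) : 0 < c B n :=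
  Finset.prod_pos fun _ _ => FinDimCStar.t_pos _

theorem c_zero (B : ℕ → FinDimCStar) : c B 0 = 1 := rfl

theorem c_one (B : ℕ → FinDimCStar) : c B 1 = (B 0).t := by
  simp [c]

theorem c_add_two (B : ℕ → FinDimCStar) (n : ℕ) : c B (n + 2) = (B (n + 1)).t * c B n := by
  have e : (n + 2 + 1) / 2 = (n + 1) / 2 + 1 := by omega
  rw [c, e, Finset.prod_range_succ', mul_comm]
  refine congrArg₂ _ (by congr 2) (Finset.prod_congr rfl fun l _ => ?_)
  have : n + 2 - 1 - 2 * (l + 1) = n - 1 - 2 * l := by omega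
  rw [this]

/-- The two products run over indices of opposite parity and together exhaust `0, …, n`. This is the
compatibility of constants demanded by `supermap_step`. -/
theorem c_succ_mul (B : ℕ → FinDimCStar) (n : ℕ) :
    c B (n + 1) * c B n = (1 : Op B n).trace := by
  induction n with
  | zero => rw [c_one, c_zero, mul_one]; rfl
  | succ n ih =>
    have h : (1 : Op B (n + 1)) = (1 : Matrix (B (n + 1)).Idx (B (n + 1)).Idx ℂ) ⊗ₖ (1 : Op B n) :=
      one_kronecker_one.symm
    rw [c_add_two, h, trace_kronecker, ← ih, mul_assoc, mul_comm (c B n)]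
    rfl

theorem C_eq (B : ℕ → FinDimCStar) {K : Set (Op B 0)} (hK : IsSection (B 0).alg K)
    (hτ : (B 0).t⁻¹ • (1 : Op B 0) ∈ K) (n : ℕ) :
    C B K n = (Jsp B (Submodule.span ℂ K) n : Set (Op B n)) ∩ c B n • states (A B n) := by
  have hJ : IsOpSystem (A B 0) (Submodule.span ℂ K) :=
    isOpSystem_span hK (inv_ne_zero (FinDimCStar.t_pos _).ne') hτ
  induction n with
  | zero =>
    rw [c_zero, one_smul]
    exact hK
  | succ n ih =>
    have hJn := isOpSystem_Jsp B hJ n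
    rw [C, ih, Jsp_succ B hJ]
    rw [A_eq_blk B n] at hJn ⊢
    rw [A_succ]
    exact supermap_step hJn (c_pos B n) (c_pos B (n + 1)) (c_succ_mul B n)

/-! ### Maps respecting equivalence -/

theorem respecting_eq (B : ℕ → FinDimCStar) {K : Set (Op B 0)} (hK : IsSection (B 0).alg K)
    (hτ : (B 0).t⁻¹ • (1 : Op B 0) ∈ K) (m : ℕ) :
    respecting B K m =
      (Jsp B (Submodule.span ℂ K) (m + 2) : Set (Op B (m + 2))) ∩
        (tensor (B (m + 2)).alg
          (tensor (B (m + 1)).alg (Jsp B (Submodule.span ℂ K) m)) : Set (Op B (m + 2))) ∩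
        c B (m + 2) • states (A B (m + 2)) := by
  have hJ : IsOpSystem (A B 0) (Submodule.span ℂ K) :=
    isOpSystem_span hK (inv_ne_zero (FinDimCStar.t_pos _).ne') hτ
  set J := Submodule.span ℂ K
  have hJm := isOpSystem_Jsp B hJ m
  have hJm1 := isOpSystem_Jsp B hJ (m + 1)
  rw [A_eq_blk B m] at hJm
  -- the differences of equivalent elements
  let N : Submodule ℂ (Op B (m + 1)) := tensor (blk Sigma.fst) (perp (blk (lab B m)) (Jsp B J m))
  have hN : ∀ {D : Op B (m + 1)}, D ∈ N ↔
      D ∈ Jsp B J (m + 1) ∧ ∀ a ∈ Jsp B J m, choiMap D a = 0 := by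
    intro D
    constructor
    · intro hD
      refine ⟨?_, fun a ha => ?_⟩
      · rw [Jsp_succ B hJ, A_succ, A_eq_blk]
        refine ⟨mem_tensor_blk.2 ⟨fun i j => ((mem_tensor_blk.1 hD).1 i j).1,
          (mem_tensor_blk.1 hD).2⟩, ?_⟩
        -- Membership in `Jₘ₊₁` is automatic: the partial trace of `D` already lies in `Jₘ^⊥`, so
        -- the scalar part is zero.
        exact (mem_tilde hJm).2 ⟨0, by simpa using trLeft_mem hD⟩
      · ext i j
        rw [choiMap_apply, pair_comm]
        exact ((mem_tensor_blk.1 hD).1 i j).2 a ha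
    · rintro ⟨hD, h⟩
      have hDA := hJm1.le hD
      rw [A_succ] at hDA
      refine mem_tensor_blk.2 ⟨fun i j => ⟨(mem_tensor_blk.1 hDA).1 i j, fun a ha => ?_⟩,
        (mem_tensor_blk.1 hDA).2⟩
      rw [pair_comm, ← choiMap_apply, h a ha]
      rfl
  have hNstar : ∀ D ∈ N, Dᴴ ∈ N := by
    intro D hD
    refine mem_tensor_blk.2 ⟨fun i j => ?_, fun i j hij => ?_⟩
    · rw [slice_conjTranspose]
      exact conjTranspose_mem_perp (fun _ => conjTranspose_mem_blk) hJm.star_mem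
        ((mem_tensor_blk.1 hD).1 j i)
    · rw [slice_conjTranspose, (mem_tensor_blk.1 hD).2 j i hij.symm, conjTranspose_zero]
  have hNtr : ∀ D ∈ N, D.trace = 0 := by
    intro D hD
    rw [← trace_trLeft, ← pair_one]
    exact (trLeft_mem hD).2 1 hJm.one_mem
  have hCm : ∀ {P : Submodule ℂ (Op B m)}, C B K m ⊆ P ↔ Jsp B J m ≤ P := by
    intro P
    rw [C_eq B hK hτ, ← Submodule.span_le,
      span_inter_smul_states (isOpSystem_Jsp B hJ m) (c_pos B m)]
  -- respecting equivalence means vanishing on `N`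
  have key : ∀ X : Op B (m + 2), (∀ Y₁ ∈ C B K (m + 1), ∀ Y₂ ∈ C B K (m + 1),
      Equivalent B K m Y₁ Y₂ → choiMap X Y₁ = choiMap X Y₂) ↔ ∀ D ∈ N, choiMap X D = 0 := by
    intro X
    constructor
    · intro h
      refine le_of_isHermitian (P := LinearMap.ker (choiMap X)) hNstar fun D hD hDh => ?_
      obtain ⟨r, hr, hp⟩ := exists_smul_one_add_posSemidef hDh
      have hpos : (r • (1 : Op B (m + 1))).PosSemidef := PosSemidef.one.smul hr.le
      have htr : 0 < (r • (1 : Op B (m + 1))).trace := by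
        rw [trace_smul]
        exact mul_pos hr trace_one_pos
      -- As `D` is traceless, `r I + D` and `r I` are normalized by the same factor, and their
      -- images under `choiMap X` can be subtracted.
      have htr' : (r • (1 : Op B (m + 1)) + D).trace = (r • (1 : Op B (m + 1))).trace := by
        rw [trace_add, hNtr D hD, add_zero]
      have h1 := Submodule.smul_mem _ r hJm1.one_mem
      have e₁ := smul_mem_inter_smul_states hJm1 (c_pos B (m + 1)) h1 hpos htr
      have e₂ := smul_mem_inter_smul_states hJm1 (c_pos B (m + 1)) (add_mem h1 (hN.1 hD).1) hp
        (htr'.symm ▸ htr)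
      rw [← C_eq B hK hτ] at e₁ e₂
      rw [htr'] at e₂
      have := h _ e₂ _ e₁ ?_
      · rw [map_smul, map_smul, map_add] at this
        have hne : c B (m + 1) / (r • (1 : Op B (m + 1))).trace ≠ 0 :=
          div_ne_zero (c_pos B (m + 1)).ne' htr.ne'
        have := smul_right_injective _ hne this
        simpa using this
      · intro a ha
        have ha' : a ∈ Jsp B J m := (hCm (P := Jsp B J m)).2 le_rfl ha
        have h0 := (hN.1 hD).2 a ha'
        ext i j
        have h0' := congrFun (congrFun h0 i) j
        rw [choiMap_apply] at h0'
        simp only [choiMap_apply, map_smul, map_add]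
        rw [pair_comm] at h0' ⊢
        rw [pair_comm _ a]
        simp only [map_smul, map_add, h0']
        simp
    · intro h Y₁ hY₁ Y₂ hY₂ heq
      rw [← sub_eq_zero, ← map_sub]
      refine h _ (hN.2 ⟨?_, ?_⟩)
      · rw [C_eq B hK hτ] at hY₁ hY₂
        exact sub_mem hY₁.1 hY₂.1
      · have : ∀ a, choiMap (Y₁ - Y₂) a = choiMap Y₁ a - choiMap Y₂ a := by
          intro a
          ext i j
          rw [Matrix.sub_apply]
          simp only [choiMap_apply, map_sub]
          rw [pair_comm, map_sub, pair_comm a, pair_comm a]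
        have hle := (hCm (P := LinearMap.ker (choiMap (Y₁ - Y₂)))).1 fun a ha => by
          rw [SetLike.mem_coe, LinearMap.mem_ker, this, heq a ha, sub_self]
        exact fun a ha => hle ha
  have key2 : ∀ X ∈ A B (m + 2), (∀ D ∈ N, choiMap X D = 0) ↔
      X ∈ tensor (B (m + 2)).alg (tensor (B (m + 1)).alg (Jsp B J m)) := by
    intro X hX
    rw [A_succ, ← A_eq_blk, A_succ] at hX
    rw [FinDimCStar.alg_eq_blk, FinDimCStar.alg_eq_blk, mem_tensor_blk]
    rw [mem_tensor_blk] at hX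
    refine ⟨fun h => ⟨fun i j => ?_, hX.2⟩, fun h D hD => ?_⟩
    · have hij := mem_tensor_blk.1 (hX.1 i j)
      refine mem_tensor_blk.2 ⟨fun p q => ?_, hij.2⟩
      rw [← perp_perp hJm.le]
      refine ⟨hij.1 p q, fun a ha => ?_⟩
      -- Within a block, `E_pq ⊗ a` is an element of `N` that isolates the slice at `p, q`; outside
      -- the blocks the slice is zero.
      by_cases hpq : p.1 = q.1
      · have hD : single p q (1 : ℂ) ⊗ₖ a ∈ N := by
          refine Submodule.subset_span ⟨_, fun x y hxy => ?_, a, ha, rfl⟩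
          rw [single_apply, if_neg]
          rintro ⟨rfl, rfl⟩
          exact hxy hpq
        have h0 : choiMap X (single p q (1 : ℂ) ⊗ₖ a) i j = 0 := by rw [h _ hD]; rfl
        rw [choiMap_apply, pair_comm, pair_eq_sum_slice, Finset.sum_eq_single p,
          Finset.sum_eq_single q] at h0
        · rw [slice_kronecker, single_apply_same, one_smul] at h0
          exact h0
        · intro b _ hb
          rw [slice_kronecker, single_apply, if_neg (fun e => hb e.2.symm), zero_smul, pair_comm,
            map_zero]
        · simp
        · intro b _ hb
          refine Finset.sum_eq_zero fun b' _ => ?_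
          rw [slice_kronecker, single_apply, if_neg (fun e => hb e.1.symm), zero_smul, pair_comm,
            map_zero]
        · simp
      · rw [hij.2 p q hpq, map_zero]
    · ext i j
      rw [choiMap_apply, pair_eq_sum_slice]
      refine Finset.sum_eq_zero fun p _ => Finset.sum_eq_zero fun q _ => ?_
      exact ((mem_tensor_blk.1 hD).1 p q).2 _ ((mem_tensor_blk.1 (h.1 i j)).1 p q)
  ext X
  constructor
  · rintro ⟨hX, h⟩
    rw [C_eq B hK hτ] at hX
    exact ⟨⟨hX.1, (key2 X ((isOpSystem_Jsp B hJ _).le hX.1)).1 ((key X).1 h)⟩, hX.2⟩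
  · rintro ⟨⟨hX, h⟩, hs⟩
    refine ⟨?_, (key X).2 ((key2 X ((isOpSystem_Jsp B hJ _).le hX)).2 h)⟩
    rw [C_eq B hK hτ]
    exact ⟨hX, hs⟩

/-! ### Maps acting slicewise and insertion of tensor factors. -/

section Generic

variable {ι κ κ' α β γ δ : Type}

/-- The map `id ⊗ L`. -/
def mapSlice (L : Matrix κ κ ℂ →ₗ[ℂ] Matrix κ' κ' ℂ) :
    Matrix (ι × κ) (ι × κ) ℂ →ₗ[ℂ] Matrix (ι × κ') (ι × κ') ℂ where
  toFun X := of fun u v => L (slice u.1 v.1 X) u.2 v.2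
  map_add' X Y := by
    ext u v
    simp
  map_smul' a X := by
    ext u v
    simp

theorem slice_mapSlice (L : Matrix κ κ ℂ →ₗ[ℂ] Matrix κ' κ' ℂ) (i j : ι)
    (X : Matrix (ι × κ) (ι × κ) ℂ) : slice i j (mapSlice L X) = L (slice i j X) := rfl

theorem mapSlice_mem [Fintype ι] [DecidableEq ι] {l : ι → δ}
    {M : Submodule ℂ (Matrix κ κ ℂ)} {M' : Submodule ℂ (Matrix κ' κ' ℂ)}
    {L : Matrix κ κ ℂ →ₗ[ℂ] Matrix κ' κ' ℂ} (hL : ∀ x ∈ M, L x ∈ M')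
    {X : Matrix (ι × κ) (ι × κ) ℂ} (hX : X ∈ tensor (blk l) M) :
    mapSlice L X ∈ tensor (blk l) M' := by
  rw [mem_tensor_blk] at hX ⊢
  refine ⟨fun i j => hL _ (hX.1 i j), fun i j h => ?_⟩
  rw [slice_mapSlice, hX.2 i j h, map_zero]

theorem trLeft_mapSlice [Fintype ι] (L : Matrix κ κ ℂ →ₗ[ℂ] Matrix κ' κ' ℂ)
    (X : Matrix (ι × κ) (ι × κ) ℂ) : trLeft (mapSlice L X) = L (trLeft X) := by
  simp [trLeft_eq_sum, slice_mapSlice]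

theorem mapSlice_trLeftAdj [DecidableEq ι] (L : Matrix κ κ ℂ →ₗ[ℂ] Matrix κ' κ' ℂ)
    (b : Matrix κ κ ℂ) :
    mapSlice L (trLeftAdj b : Matrix (ι × κ) (ι × κ) ℂ) = trLeftAdj (L b) :=
  slice_ext fun i j => by simp only [slice_mapSlice, slice_trLeftAdj, map_smul]

/-- Insertion of a further tensor factor. -/
def insertEquiv (e : κ' ≃ α × β × κ) : γ × κ' ≃ α × β × γ × κ where
  toFun x := ((e x.2).1, (e x.2).2.1, x.1, (e x.2).2.2)
  invFun y := (y.2.2.1, e.symm (y.1, y.2.1, y.2.2.2))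
  left_inv x := by simp
  right_inv y := by simp

/-- The inserted factor is outermost on one side and third on the other, so tracing it out there
becomes a partial trace inside each double slice. -/
theorem trLeft_submatrix [Fintype γ] (e : κ' ≃ α × β × κ)
    (X : Matrix (α × β × γ × κ) (α × β × γ × κ) ℂ) :
    trLeft (X.submatrix (insertEquiv e) (insertEquiv e)) =
      (mapSlice (mapSlice trLeft) X).submatrix e e := rfl

theorem trLeftAdj_submatrix [DecidableEq γ] (e : κ' ≃ α × β × κ)
    (Z : Matrix (α × β × κ) (α × β × κ) ℂ) :
    trLeftAdj (Z.submatrix e e) =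
      (mapSlice (mapSlice trLeftAdj) Z :
        Matrix (α × β × γ × κ) (α × β × γ × κ) ℂ).submatrix (insertEquiv e) (insertEquiv e) := rfl

theorem submatrix_equiv_injective {e : κ' ≃ κ} {X Y : Matrix κ κ ℂ}
    (h : X.submatrix e e = Y.submatrix e e) : X = Y := by
  have := congrArg (fun Z => Z.submatrix e.symm e.symm) h
  simpa using this

end Generic

/-! ### Transport of the subspaces `Jₙ` along a reordering of factors. -/

/-- The order `s₀, s₁, s₂, 1, 2, …`. -/
def ord (s₀ s₁ s₂ : ℕ) : ℕ → ℕ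
  | 0 => s₀
  | 1 => s₁
  | 2 => s₂
  | k + 3 => k + 1

section Reorder

variable (B : ℕ → FinDimCStar) {s₀ s₁ s₂ : ℕ} {a b : ℕ}

/-- The sequence `B_{s₀}, B_{s₁}, B_{s₂}, B₁, B₂, …`. -/
abbrev ordSeq (s₀ s₁ s₂ : ℕ) : ℕ → FinDimCStar := fun i => B (ord s₀ s₁ s₂ i)

variable (e₀ : TIdx (ordSeq B s₀ s₁ s₂) 2 ≃ (B a).Idx × (B b).Idx × TIdx B 0)

/-- The extension of an identification of the first three factors to the further ones. -/
def reorderEquiv : (k : ℕ) → TIdx (ordSeq B s₀ s₁ s₂) (k + 2) ≃ (B a).Idx × (B b).Idx × TIdx B k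
  | 0 => e₀
  | k + 1 => (insertEquiv (reorderEquiv k) :
      (B (k + 1)).Idx × TIdx (ordSeq B s₀ s₁ s₂) (k + 2) ≃
        (B a).Idx × (B b).Idx × (B (k + 1)).Idx × TIdx B k)

/-- Compatibility of `e₀` with the block structure. -/
def LabCompat : Prop :=
  ∀ x y, (e₀ x).1.1 = (e₀ y).1.1 → (e₀ x).2.1.1 = (e₀ y).2.1.1 →
    lab B 0 (e₀ x).2.2 = lab B 0 (e₀ y).2.2 →
      lab (ordSeq B s₀ s₁ s₂) 2 x = lab (ordSeq B s₀ s₁ s₂) 2 y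

variable {B e₀}

theorem LabCompat.reorderEquiv (h : LabCompat B e₀) (k : ℕ)
    (x y : TIdx (ordSeq B s₀ s₁ s₂) (k + 2))
    (h1 : (reorderEquiv B e₀ k x).1.1 = (reorderEquiv B e₀ k y).1.1)
    (h2 : (reorderEquiv B e₀ k x).2.1.1 = (reorderEquiv B e₀ k y).2.1.1)
    (h3 : lab B k (reorderEquiv B e₀ k x).2.2 = lab B k (reorderEquiv B e₀ k y).2.2) :
    lab (ordSeq B s₀ s₁ s₂) (k + 2) x = lab (ordSeq B s₀ s₁ s₂) (k + 2) y := by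
  induction k with
  | zero => exact h x y h1 h2 h3
  | succ k ih =>
    have h3' := List.cons.inj h3
    exact congrArg₂ List.cons h3'.1 (ih x.2 y.2 h1 h2 h3'.2)

theorem submatrix_mem_A (h : LabCompat B e₀) {k : ℕ}
    {X : Matrix ((B a).Idx × (B b).Idx × TIdx B k) ((B a).Idx × (B b).Idx × TIdx B k) ℂ}
    (hX : X ∈ tensor (B a).alg (tensor (B b).alg (A B k))) :
    X.submatrix (reorderEquiv B e₀ k) (reorderEquiv B e₀ k) ∈ A (ordSeq B s₀ s₁ s₂) (k + 2) := by
  rw [A_eq_blk]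
  intro x y hxy
  rw [FinDimCStar.alg_eq_blk, FinDimCStar.alg_eq_blk, A_eq_blk, tensor_blk_blk, tensor_blk_blk]
    at hX
  refine hX _ _ fun e => hxy ?_
  simp only [Prod.mk.injEq] at e
  exact h.reorderEquiv k x y e.1 e.2.1 e.2.2

/-- The normalized partial trace over two factors. -/
def reduceTwo (B : ℕ → FinDimCStar) (k : ℕ) : Op B (k + 2) →ₗ[ℂ] Op B k :=
  (B (k + 1)).t⁻¹ • (S B k ∘ₗ S B (k + 1))

theorem reduceTwo_mem {k : ℕ} {X : Op B (k + 2)} (hX : X ∈ A B (k + 2)) :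
    reduceTwo B k X ∈ A B k := by
  refine Submodule.smul_mem _ _ ?_
  exact trLeft_mem (ι := (B (k + 1)).Idx) (l := Sigma.fst)
    (trLeft_mem (ι := (B (k + 2)).Idx) (l := Sigma.fst) hX)

theorem reduceTwo_eq {k : ℕ} {X : Op B (k + 2)} {Z : Op B k} (h : S B (k + 1) X = SAdj B k Z) :
    reduceTwo B k X = Z := by
  have h2 : S B k (SAdj B k Z) = (B (k + 1)).t • Z := trLeft_trLeftAdj Z
  rw [reduceTwo, LinearMap.smul_apply, LinearMap.comp_apply, h, h2,
    inv_smul_smul₀ (FinDimCStar.t_pos _).ne']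

/-- The preimage under `S*` is determined by `X` through `reduceTwo`. This replaces an existential
by an equation, which can be checked slice by slice. -/
theorem mem_Jsp_add_two {J : Submodule ℂ (Op B 0)} {k : ℕ} {X : Op B (k + 2)}
    (hX : X ∈ A B (k + 2)) :
    X ∈ Jsp B J (k + 2) ↔ S B (k + 1) X = SAdj B k (reduceTwo B k X) ∧
      reduceTwo B k X ∈ Jsp B J k := by
  constructor
  · rintro ⟨-, Z, hZ, h⟩
    have := reduceTwo_eq h.symm
    subst this
    exact ⟨h.symm, hZ⟩
  · rintro ⟨h1, h2⟩
    exact ⟨hX, _, h2, h1.symm⟩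

/-- Peeling the factors `k + 2` and `k + 1` off the reordered operator is the same as peeling them
off every double slice of `X`. Both sides split into the same equation and a condition on the
reduced operator `Z`, to which the induction hypothesis applies since slicewise maps preserve the
form `I ⊗ W` of the partial trace. -/
theorem submatrix_mem_Jsp_step (hlab : LabCompat B e₀) {J : Submodule ℂ (Op B 0)}
    {J' : Submodule ℂ (Op (ordSeq B s₀ s₁ s₂) 0)} {k : ℕ}
    (ih : ∀ X : Matrix ((B a).Idx × (B b).Idx × TIdx B k) ((B a).Idx × (B b).Idx × TIdx B k) ℂ,
      X ∈ tensor (B a).alg (tensor (B b).alg (A B k)) → (∃ W, trLeft X = trLeftAdj W) →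
      (X.submatrix (reorderEquiv B e₀ k) (reorderEquiv B e₀ k) ∈
          Jsp (ordSeq B s₀ s₁ s₂) J' (k + 2) ↔
        X ∈ tensor (B a).alg (tensor (B b).alg (Jsp B J k))))
    (X : Matrix ((B a).Idx × (B b).Idx × TIdx B (k + 2)) ((B a).Idx × (B b).Idx × TIdx B (k + 2)) ℂ)
    (hX : X ∈ tensor (B a).alg (tensor (B b).alg (A B (k + 2))))
    (hW : ∃ W, trLeft X = trLeftAdj W) :
    X.submatrix (reorderEquiv B e₀ (k + 2)) (reorderEquiv B e₀ (k + 2)) ∈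
        Jsp (ordSeq B s₀ s₁ s₂) J' (k + 4) ↔
      X ∈ tensor (B a).alg (tensor (B b).alg (Jsp B J (k + 2))) := by
  let Z := mapSlice (ι := (B a).Idx) (mapSlice (ι := (B b).Idx) (reduceTwo B k)) X
  have hZ : Z ∈ tensor (B a).alg (tensor (B b).alg (A B k)) :=
    mapSlice_mem (l := Sigma.fst)
      (fun _ h => mapSlice_mem (l := Sigma.fst) (fun _ h => reduceTwo_mem h) h) hX
  have hZW : ∃ W, trLeft Z = trLeftAdj W := by
    obtain ⟨W, hW⟩ := hW
    exact ⟨reduceTwo B k W, by rw [trLeft_mapSlice, hW, mapSlice_trLeftAdj]⟩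
  have hS : S (ordSeq B s₀ s₁ s₂) (k + 3)
      (X.submatrix (reorderEquiv B e₀ (k + 2)) (reorderEquiv B e₀ (k + 2))) =
      (mapSlice (mapSlice (S B (k + 1))) X).submatrix (reorderEquiv B e₀ (k + 1))
        (reorderEquiv B e₀ (k + 1)) :=
    trLeft_submatrix (γ := (B (k + 2)).Idx) (reorderEquiv B e₀ (k + 1)) X
  have hSAdj : ∀ Y, SAdj (ordSeq B s₀ s₁ s₂) (k + 2)
      (Y.submatrix (reorderEquiv B e₀ k) (reorderEquiv B e₀ k)) =
      (mapSlice (mapSlice (SAdj B k)) Y).submatrix (reorderEquiv B e₀ (k + 1))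
        (reorderEquiv B e₀ (k + 1)) := fun Y =>
    trLeftAdj_submatrix (γ := (B (k + 1)).Idx) (reorderEquiv B e₀ k) Y
  have hred : reduceTwo (ordSeq B s₀ s₁ s₂) (k + 2)
      (X.submatrix (reorderEquiv B e₀ (k + 2)) (reorderEquiv B e₀ (k + 2))) =
      Z.submatrix (reorderEquiv B e₀ k) (reorderEquiv B e₀ k) := rfl
  have hslice : mapSlice (mapSlice (S B (k + 1))) X = mapSlice (mapSlice (SAdj B k)) Z ↔
      ∀ i j p q, S B (k + 1) (slice p q (slice i j X)) =
        SAdj B k (reduceTwo B k (slice p q (slice i j X))) := by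
    constructor
    · intro h i j p q
      exact congrArg (fun Y => slice p q (slice i j Y)) h
    · intro h
      exact slice_ext fun i j => slice_ext fun p q => h i j p q
  rw [mem_Jsp_add_two (submatrix_mem_A hlab hX), hred, ih Z hZ hZW, hS, hSAdj]
  have hinj : ∀ Y Y' : Matrix ((B a).Idx × (B b).Idx × TIdx B (k + 1))
      ((B a).Idx × (B b).Idx × TIdx B (k + 1)) ℂ,
      Y.submatrix (reorderEquiv B e₀ (k + 1)) (reorderEquiv B e₀ (k + 1)) =
        Y'.submatrix (reorderEquiv B e₀ (k + 1)) (reorderEquiv B e₀ (k + 1)) ↔ Y = Y' :=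
    fun Y Y' => ⟨submatrix_equiv_injective, fun h => by rw [h]⟩
  rw [hinj, hslice]
  simp only [FinDimCStar.alg_eq_blk, mem_tensor_blk] at hX hZ ⊢
  constructor
  · rintro ⟨h1, h2⟩
    refine ⟨fun i j => ⟨fun p q => ?_, (hX.1 i j).2⟩, hX.2⟩
    exact (mem_Jsp_add_two ((hX.1 i j).1 p q)).2 ⟨h1 i j p q, (h2.1 i j).1 p q⟩
  · rintro ⟨h, -⟩
    have h' := fun i j p q => (mem_Jsp_add_two ((hX.1 i j).1 p q)).1 ((h i j).1 p q)
    exact ⟨fun i j p q => (h' i j p q).1,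
      fun i j => ⟨fun p q => (h' i j p q).2, (hZ.1 i j).2⟩, hZ.2⟩

end Reorder

/-! ### The two base cases and the parity inductions for the full state space. -/

section Base

variable (B : ℕ → FinDimCStar) (a b : ℕ)

/-- The identification for the order `0, b, a`. -/
def zeroFirst : TIdx (ordSeq B 0 b a) 2 ≃ (B a).Idx × (B b).Idx × TIdx B 0 :=
  Equiv.refl ((B a).Idx × (B b).Idx × (B 0).Idx)

/-- The identification for the order `b, a, 0`. -/
def zeroLast : TIdx (ordSeq B b a 0) 2 ≃ (B a).Idx × (B b).Idx × TIdx B 0 where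
  toFun x := (x.2.1, x.2.2, x.1)
  invFun y := (y.2.2, y.1, y.2.1)
  left_inv _ := rfl
  right_inv _ := rfl

theorem labCompat_zeroFirst : LabCompat B (zeroFirst B a b) := by
  rintro ⟨x, y, z⟩ ⟨x', y', z'⟩ h1 h2 h3
  have h1 : x.1 = x'.1 := h1
  have h2 : y.1 = y'.1 := h2
  have h3 : [z.1.val] = [z'.1.val] := h3
  change [x.1.val, y.1.val, z.1.val] = [x'.1.val, y'.1.val, z'.1.val]
  rw [h1, h2, List.cons.inj h3 |>.1]

theorem labCompat_zeroLast : LabCompat B (zeroLast B a b) := by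
  rintro ⟨z, x, y⟩ ⟨z', x', y'⟩ h1 h2 h3
  have h1 : x.1 = x'.1 := h1
  have h2 : y.1 = y'.1 := h2
  have h3 : [z.1.val] = [z'.1.val] := h3
  change [z.1.val, x.1.val, y.1.val] = [z'.1.val, x'.1.val, y'.1.val]
  rw [h1, h2, List.cons.inj h3 |>.1]

variable {B a b}

/-- Both sides hold: with `J₀` the whole algebra the right one is `hX`, while the left one only asks
that the partial trace have the form `I ⊗ W`, which is `hW`. -/
theorem submatrix_mem_Jsp_zeroFirst
    (X : Matrix ((B a).Idx × (B b).Idx × TIdx B 0) ((B a).Idx × (B b).Idx × TIdx B 0) ℂ)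
    (hX : X ∈ tensor (B a).alg (tensor (B b).alg (A B 0)))
    (hW : ∃ W, trLeft X = trLeftAdj W) :
    X.submatrix (reorderEquiv B (zeroFirst B a b) 0) (reorderEquiv B (zeroFirst B a b) 0) ∈
        Jsp (ordSeq B 0 b a) (A (ordSeq B 0 b a) 0) 2 ↔
      X ∈ tensor (B a).alg (tensor (B b).alg (Jsp B (A B 0) 0)) := by
  have hA := submatrix_mem_A (labCompat_zeroFirst B a b) hX
  refine ⟨fun _ => hX, fun _ => (mem_Jsp_add_two hA).2 ⟨?_, reduceTwo_mem hA⟩⟩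
  obtain ⟨W, hW⟩ := hW
  have h : S (ordSeq B 0 b a) 1 (X.submatrix (reorderEquiv B (zeroFirst B a b) 0)
      (reorderEquiv B (zeroFirst B a b) 0)) = SAdj (ordSeq B 0 b a) 0 W := hW
  rw [reduceTwo_eq h, h]

/-- For the full algebra `J̃` consists of the scalars, so the right side says that each double slice
of `X` has a scalar partial trace over `B₁`. Collecting these scalars into an operator `Y` gives `S
X' = I ⊗ Y` for the reordered `X'`; the further demand that `Y` itself have scalar partial trace
comes from `hW`. -/
theorem submatrix_mem_Jsp_zeroLast
    (X : Matrix ((B a).Idx × (B b).Idx × TIdx B 1) ((B a).Idx × (B b).Idx × TIdx B 1) ℂ)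
    (hX : X ∈ tensor (B a).alg (tensor (B b).alg (A B 1)))
    (hW : ∃ W, trLeft X = trLeftAdj W) :
    X.submatrix (reorderEquiv B (zeroLast B a b) 1) (reorderEquiv B (zeroLast B a b) 1) ∈
        Jsp (ordSeq B b a 0) (A (ordSeq B b a 0) 0) 3 ↔
      X ∈ tensor (B a).alg (tensor (B b).alg (Jsp B (A B 0) 1)) := by
  have hA := submatrix_mem_A (labCompat_zeroLast B a b) hX
  have hJ1 : ∀ (B : ℕ → FinDimCStar) (Y : Op B 1), Y ∈ Jsp B (A B 0) 1 ↔
      Y ∈ A B 1 ∧ ∃ r : ℂ, r • (1 : Op B 0) = trLeft Y := by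
    intro B Y
    rw [Jsp, A_eq_blk B 0, tilde_self, ← Submodule.mem_span_singleton]
    rfl
  have hS : S (ordSeq B b a 0) 2 (X.submatrix (reorderEquiv B (zeroLast B a b) 1)
      (reorderEquiv B (zeroLast B a b) 1)) =
      (mapSlice (mapSlice (S B 0)) X).submatrix (zeroLast B a b) (zeroLast B a b) := rfl
  simp only [FinDimCStar.alg_eq_blk, mem_tensor_blk] at hX ⊢
  constructor
  · rintro ⟨-, Y, hY, h⟩
    rw [hS] at h
    refine ⟨fun i j => ⟨fun p q => (hJ1 B _).2 ⟨(hX.1 i j).1 p q, Y (i, p) (j, q), ?_⟩,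
      (hX.1 i j).2⟩, hX.2⟩
    ext x y
    have := congrFun (congrFun h (x, i, p)) (y, j, q)
    refine Eq.trans ?_ this
    change Y (i, p) (j, q) * (1 : Matrix (B 0).Idx (B 0).Idx ℂ) x y =
      (1 : Matrix (B 0).Idx (B 0).Idx ℂ) x y * Y (i, p) (j, q)
    exact mul_comm _ _
  · rintro ⟨h, -⟩
    have h' := fun i j p q => ((hJ1 B _).1 ((h i j).1 p q)).2
    choose y hy using h'
    let Y : Op (ordSeq B b a 0) 1 := of fun u v => y u.1 v.1 u.2 v.2
    -- The chosen scalars are normalized traces of slices, through which `Y` inherits block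
    -- structure and partial trace from `X`.
    have htr : ∀ i j p q, y i j p q = (B 0).t⁻¹ * (slice p q (slice i j X)).trace := by
      intro i j p q
      have e : (slice p q (slice i j X)).trace = y i j p q * (B 0).t := by
        rw [← trace_trLeft (ι := (B 1).Idx) (κ := (B 0).Idx), ← hy i j p q, trace_smul]
        rfl
      rw [e, mul_comm, mul_inv_cancel_right₀ (FinDimCStar.t_pos _).ne']
    refine ⟨hA, Y, (hJ1 _ Y).2 ⟨?_, ?_⟩, ?_⟩
    · refine (mem_tensor_blk (l := (Sigma.fst : (B a).Idx → _)) (M := (B b).alg)).2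
        ⟨fun i j p q hpq => ?_, fun i j hij => ?_⟩
      · change y i j p q = 0
        rw [htr, (hX.1 i j).2 p q hpq]
        simp
      · ext p q
        change y i j p q = 0
        rw [htr, hX.2 i j hij]
        simp
    · obtain ⟨W, hW⟩ := hW
      have e : ∀ p q : (B b).Idx, ∑ i, (slice p q (slice i i X)).trace =
          (1 : Matrix (B b).Idx (B b).Idx ℂ) p q * W.trace := by
        intro p q
        have := congrArg (fun Z => (slice p q Z).trace) hW
        simpa only [trLeft_eq_sum, map_sum, slice_trLeftAdj, trace_smul, trace_sum,
          smul_eq_mul] using this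
      have e' : ∀ p q : (B b).Idx, (B 0).t⁻¹ * W.trace * (1 : Matrix (B b).Idx (B b).Idx ℂ) p q =
          ∑ i, y i i p q := by
        intro p q
        rw [Finset.sum_congr rfl fun i _ => htr i i p q, ← Finset.mul_sum, e, mul_assoc,
          mul_comm W.trace]
      exact ⟨(B 0).t⁻¹ * W.trace, by ext p q; exact e' p q⟩
    · rw [hS]
      ext ⟨x, i, p⟩ ⟨x', j, q⟩
      have := congrFun (congrFun (hy i j p q) x) x'
      refine Eq.trans ?_ this
      change (1 : Matrix (B 0).Idx (B 0).Idx ℂ) x x' * y i j p q =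
        y i j p q * (1 : Matrix (B 0).Idx (B 0).Idx ℂ) x x'
      exact mul_comm _ _

theorem submatrix_mem_Jsp_even (k : ℕ) (hk : Even k)
    (X : Matrix ((B a).Idx × (B b).Idx × TIdx B k) ((B a).Idx × (B b).Idx × TIdx B k) ℂ)
    (hX : X ∈ tensor (B a).alg (tensor (B b).alg (A B k)))
    (hW : ∃ W, trLeft X = trLeftAdj W) :
    X.submatrix (reorderEquiv B (zeroFirst B a b) k) (reorderEquiv B (zeroFirst B a b) k) ∈
        Jsp (ordSeq B 0 b a) (A (ordSeq B 0 b a) 0) (k + 2) ↔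
      X ∈ tensor (B a).alg (tensor (B b).alg (Jsp B (A B 0) k)) := by
  induction k using Nat.twoStepInduction with
  | zero => exact submatrix_mem_Jsp_zeroFirst X hX hW
  | one => simp at hk
  | more k ih _ =>
    have hk' : Even k := by simpa [Nat.even_add] using hk
    exact submatrix_mem_Jsp_step (labCompat_zeroFirst B a b) (ih hk') X hX hW

theorem submatrix_mem_Jsp_odd (k : ℕ) (hk : Odd k)
    (X : Matrix ((B a).Idx × (B b).Idx × TIdx B k) ((B a).Idx × (B b).Idx × TIdx B k) ℂ)
    (hX : X ∈ tensor (B a).alg (tensor (B b).alg (A B k)))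
    (hW : ∃ W, trLeft X = trLeftAdj W) :
    X.submatrix (reorderEquiv B (zeroLast B a b) k) (reorderEquiv B (zeroLast B a b) k) ∈
        Jsp (ordSeq B b a 0) (A (ordSeq B b a 0) 0) (k + 2) ↔
      X ∈ tensor (B a).alg (tensor (B b).alg (Jsp B (A B 0) k)) := by
  induction k using Nat.twoStepInduction with
  | zero => simp at hk
  | one => exact submatrix_mem_Jsp_zeroLast X hX hW
  | more k ih _ =>
    have hk' : Odd k := by simpa [Nat.odd_add] using hk
    exact submatrix_mem_Jsp_step (labCompat_zeroLast B a b) (ih hk') X hX hW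

/-- For even `k` the product uses the odd positions of the new sequence: position `1` holds `B b`,
and the later ones hold the factors that occur in `c B k`. -/
theorem c_zeroFirst (k : ℕ) (hk : Even k) : c (ordSeq B 0 b a) (k + 2) = (B b).t * c B k := by
  induction k using Nat.twoStepInduction with
  | zero => rw [c_add_two]; rfl
  | one => simp at hk
  | more k ih _ =>
    rw [c_add_two, ih (by simpa [Nat.even_add] using hk), c_add_two B k]
    exact mul_left_comm _ _ _

theorem c_zeroLast (k : ℕ) (hk : Odd k) : c (ordSeq B b a 0) (k + 2) = (B b).t * c B k := by
  induction k using Nat.twoStepInduction with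
  | zero => simp at hk
  | one =>
    rw [c_add_two, c_one, c_one]
    exact mul_comm _ _
  | more k ih _ =>
    rw [c_add_two, ih (by simpa [Nat.odd_add] using hk), c_add_two B k]
    exact mul_left_comm _ _ _

end Base

/-! ### The full state space: comparison with reordered supermaps. -/

section Full

variable (B : ℕ → FinDimCStar)

theorem span_states : Submodule.span ℂ (states (B 0).alg) = (B 0).alg := by
  have h := span_inter_smul_states (isOpSystem_blk (Sigma.fst : (B 0).Idx → _)) one_pos
  rw [one_smul] at h
  rw [FinDimCStar.alg_eq_blk]
  conv_rhs => rw [← h]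
  congr 1
  ext x
  exact ⟨fun hx => ⟨hx.1, hx⟩, fun hx => hx.2⟩

theorem CFull_eq (n : ℕ) :
    CFull B n = (Jsp B (A B 0) n : Set (Op B n)) ∩ c B n • states (A B n) := by
  have h := C_eq B (K := states (B 0).alg) ?_ ?_ n
  · rw [span_states] at h
    exact h
  · rw [IsSection, span_states]
    ext x
    exact ⟨fun hx => ⟨hx.1, hx⟩, fun hx => hx.2⟩
  · have ht := FinDimCStar.t_pos (B 0)
    refine ⟨Submodule.smul_mem _ _ (one_mem_blk _), PosSemidef.one.smul ?_, ?_⟩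
    · exact inv_nonneg.2 ht.le
    · rw [trace_smul, smul_eq_mul]
      exact inv_mul_cancel₀ ht.ne'

theorem ofCoord_coord (n : ℕ) (x : TIdx B n) : ofCoord B n (coord B n x) = x := by
  induction n with
  | zero => rfl
  | succ n ih =>
    refine Prod.ext ?_ ?_
    · simp [ofCoord, coord]
    · simp [ofCoord, coord, ih]

theorem ord_le {s₀ s₁ s₂ n : ℕ} (h₀ : s₀ ≤ n + 2) (h₁ : s₁ ≤ n + 2) (h₂ : s₂ ≤ n + 2) (i : ℕ)
    (hi : i ≤ n + 2) : ord s₀ s₁ s₂ i ≤ n + 2 := by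
  unfold ord
  split <;> omega

/-- `ord` matches on its argument, so position `k + 3` of `ordSeq` is `B (k + 1)` by reduction, as
the type of `reorderEquiv` requires. -/
theorem oddOrder_eq (m : ℕ) : oddOrder (m + 1) = ord 0 (m + 1) (m + 2) := by
  funext i
  rcases i with _ | _ | _ | i <;> simp [oddOrder, ord]

theorem evenOrder_eq (m : ℕ) : evenOrder (m + 1) = ord (m + 1) (m + 2) 0 := by
  funext i
  rcases i with _ | _ | _ | i <;> simp [evenOrder, ord]

theorem CReordered_congr {n : ℕ} {σ τ : ℕ → ℕ} (h : σ = τ) (hσ : ∀ i, i ≤ n → σ i ≤ n)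
    (hτ : ∀ i, i ≤ n → τ i ≤ n) : CReordered B σ hσ = CReordered B τ hτ := by
  subst h
  rfl

/-- The factors after the first three keep their relative order, so only the base identification
`he` depends on the permutation. -/
theorem reorderEquiv_reorder {s₀ s₁ s₂ m : ℕ}
    {e₀ : TIdx (ordSeq B s₀ s₁ s₂) 2 ≃ (B (m + 2)).Idx × (B (m + 1)).Idx × TIdx B 0}
    (hs : ∀ i, i ≤ m + 2 → ord s₀ s₁ s₂ i ≤ m + 2) (x : TIdx B (m + 2))
    (he : e₀ (ofCoord (ordSeq B s₀ s₁ s₂) 2 fun i => coord B (m + 2) x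
        ⟨ord s₀ s₁ s₂ i, Nat.lt_succ_of_le (hs i (by omega))⟩) =
      (coord B (m + 2) x ⟨m + 2, by omega⟩, coord B (m + 2) x ⟨m + 1, by omega⟩,
        coord B (m + 2) x ⟨0, by omega⟩)) :
    reorderEquiv B e₀ m (reorder B (ord s₀ s₁ s₂) hs x) = x := by
  have key : ∀ k (hk : k ≤ m), reorderEquiv B e₀ k (ofCoord (ordSeq B s₀ s₁ s₂) (k + 2)
      fun i => coord B (m + 2) x ⟨ord s₀ s₁ s₂ i, Nat.lt_succ_of_le (hs i (by omega))⟩) =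
      (coord B (m + 2) x ⟨m + 2, by omega⟩, coord B (m + 2) x ⟨m + 1, by omega⟩,
        ofCoord B k fun i => coord B (m + 2) x ⟨i, by omega⟩) := by
    intro k hk
    induction k with
    | zero => exact he
    | succ k ih =>
      have := ih (by omega)
      refine Prod.ext (congrArg (fun y => y.1) this) (Prod.ext (congrArg (fun y => y.2.1) this)
        (Prod.ext rfl (congrArg (fun y => y.2.2) this)))
  exact (key m le_rfl).trans (ofCoord_coord B (m + 2) x)

theorem mem_CReordered {s₀ s₁ s₂ m : ℕ}
    {e₀ : TIdx (ordSeq B s₀ s₁ s₂) 2 ≃ (B (m + 2)).Idx × (B (m + 1)).Idx × TIdx B 0}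
    (hs : ∀ i, i ≤ m + 2 → ord s₀ s₁ s₂ i ≤ m + 2)
    (he : ∀ x, reorderEquiv B e₀ m (reorder B (ord s₀ s₁ s₂) hs x) = x) (X : Op B (m + 2)) :
    X ∈ CReordered B (ord s₀ s₁ s₂) hs ↔
      X.submatrix (reorderEquiv B e₀ m) (reorderEquiv B e₀ m) ∈
        CFull (ordSeq B s₀ s₁ s₂) (m + 2) := by
  have hr : reorder B (ord s₀ s₁ s₂) hs = (reorderEquiv B e₀ m).symm := by
    funext x
    rw [Equiv.eq_symm_apply]
    exact he x
  rw [CReordered, hr]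
  constructor
  · rintro ⟨Y, hY, rfl⟩
    simpa using hY
  · intro h
    exact ⟨_, h, by simp⟩

/-- Positivity, trace and block structure survive reindexing, so only the `Jsp` condition remains to
be compared. The hypothesis of `hJ` on the partial trace is supplied by `X ∈ Jₘ₊₂`. -/
theorem respecting_states_eq {s₀ s₁ s₂ m : ℕ}
    {e₀ : TIdx (ordSeq B s₀ s₁ s₂) 2 ≃ (B (m + 2)).Idx × (B (m + 1)).Idx × TIdx B 0}
    (hlab : LabCompat B e₀) (hs : ∀ i, i ≤ m + 2 → ord s₀ s₁ s₂ i ≤ m + 2)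
    (he : ∀ x, reorderEquiv B e₀ m (reorder B (ord s₀ s₁ s₂) hs x) = x)
    (hc : c (ordSeq B s₀ s₁ s₂) (m + 2) = c B (m + 2))
    (hJ : ∀ X : Op B (m + 2), X ∈ tensor (B (m + 2)).alg (tensor (B (m + 1)).alg (A B m)) →
      (∃ W, S B (m + 1) X = SAdj B m W) →
      (X.submatrix (reorderEquiv B e₀ m) (reorderEquiv B e₀ m) ∈
          Jsp (ordSeq B s₀ s₁ s₂) (A (ordSeq B s₀ s₁ s₂) 0) (m + 2) ↔
        X ∈ tensor (B (m + 2)).alg (tensor (B (m + 1)).alg (Jsp B (A B 0) m)))) :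
    (Jsp B (A B 0) (m + 2) : Set (Op B (m + 2))) ∩
        (tensor (B (m + 2)).alg (tensor (B (m + 1)).alg (Jsp B (A B 0) m)) :
          Set (Op B (m + 2))) ∩ c B (m + 2) • states (A B (m + 2)) =
      CFull B (m + 2) ∩ CReordered B (ord s₀ s₁ s₂) hs := by
  ext X
  rw [Set.mem_inter_iff, Set.mem_inter_iff, Set.mem_inter_iff, mem_CReordered B hs he, CFull_eq,
    CFull_eq, hc, Set.mem_inter_iff, Set.mem_inter_iff, and_right_comm]
  refine and_congr_right fun ⟨h1, h2⟩ => ?_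
  have hW : ∃ W, S B (m + 1) X = SAdj B m W := by
    obtain ⟨-, W, -, hW⟩ := h1
    exact ⟨W, hW.symm⟩
  rw [mem_smul_states (c_pos B _)] at h2 ⊢
  rw [SetLike.mem_coe, SetLike.mem_coe, ← hJ X h2.1 hW]
  refine (and_iff_left ⟨submatrix_mem_A hlab h2.1, h2.2.1.submatrix _, ?_⟩).symm
  rw [← h2.2.2]
  exact Equiv.sum_comp (reorderEquiv B e₀ m) fun x => X x x

end Full

end Supermap
end

theorem mainTheorem6 (B : ℕ → Supermap.FinDimCStar) (K : Set (Supermap.Op B 0))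
    (hK : Supermap.IsSection (B 0).alg K)
    (hτ : (B 0).t⁻¹ • (1 : Supermap.Op B 0) ∈ K)
    (m : ℕ) :
    Supermap.respecting B K m =
        (Supermap.Jsp B (Submodule.span ℂ K) (m + 2) : Set (Supermap.Op B (m + 2))) ∩
        (Supermap.tensor (B (m + 2)).alg
          (Supermap.tensor (B (m + 1)).alg (Supermap.Jsp B (Submodule.span ℂ K) m)) :
            Set (Supermap.Op B (m + 2))) ∩
        Supermap.c B (m + 2) • Supermap.states (Supermap.A B (m + 2)) ∧
    (K = Supermap.states (B 0).alg →
      (Odd (m + 1) → Supermap.respecting B K m =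
        Supermap.CFull B (m + 2) ∩
          Supermap.CReordered B (Supermap.oddOrder (m + 1)) (Supermap.oddOrder_le (m + 1))) ∧
      (Even (m + 1) → Supermap.respecting B K m =
        Supermap.CFull B (m + 2) ∩
          Supermap.CReordered B (Supermap.evenOrder (m + 1)) (Supermap.evenOrder_le (m + 1)))) := by
  have h := Supermap.respecting_eq B hK hτ m
  refine ⟨h, fun hKs => ?_⟩
  have hspan : Submodule.span ℂ K = Supermap.A B 0 := by
    rw [hKs]
    exact Supermap.span_states B
  rw [h, hspan]
  constructor
  · intro hm
    -- The parity inductions concern `Jₘ`, where `m = n - 1`, so the parity of `n` is switched.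
    have hm' : Even m := by
      rw [Nat.odd_add_one] at hm
      simpa using hm
    have hs := Supermap.ord_le (n := m) (s₀ := 0) (s₁ := m + 1) (s₂ := m + 2) (by omega)
      (by omega) (by omega)
    rw [Supermap.CReordered_congr B (Supermap.oddOrder_eq m) _ hs]
    refine Supermap.respecting_states_eq B (Supermap.labCompat_zeroFirst B (m + 2) (m + 1)) hs
      (fun x => Supermap.reorderEquiv_reorder B hs x rfl) ?_
      (Supermap.submatrix_mem_Jsp_even m hm')
    rw [Supermap.c_zeroFirst m hm', Supermap.c_add_two]
  · intro hm
    have hm' : Odd m := by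
      rw [Nat.even_add_one] at hm
      simpa using hm
    have hs := Supermap.ord_le (n := m) (s₀ := m + 1) (s₁ := m + 2) (s₂ := 0) (by omega)
      (by omega) (by omega)
    rw [Supermap.CReordered_congr B (Supermap.evenOrder_eq m) _ hs]
    refine Supermap.respecting_states_eq B (Supermap.labCompat_zeroLast B (m + 2) (m + 1)) hs
      (fun x => Supermap.reorderEquiv_reorder B hs x rfl) ?_
      (Supermap.submatrix_mem_Jsp_odd m hm')
    rw [Supermap.c_zeroLast m hm', Supermap.c_add_two]
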